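/- Let $n\ge 3$ and $\Bbbk\in\{\mathbb R,\mathbb C\}$, with the bilinear scalar product $\langle a,b\rangle=\sum_k a_kb_k$ on $\Bbbk^n$. For functions of $u\in\mathbb Z^n$ put $T_iF(u)=F(u+e_i)$, $T_i^-=T_i^{-1}$, $\Delta_i=T_i-1$. A *Darboux–Egoroff lattice* in $\Bbbk^n$ is a map $x:\mathbb Z^n\to\Bbbk^n$ with edges $X_i=T_ix-x$, $X_i^-=T_i^-x-x$ such that for every $u$: the vectors $X_1(u),\dots,X_n(u)$ are linearly independent, the points $x,T_ix,T_jx,T_iT_jx$ are coplanar, and $\langle X_i,X_j^-\rangle=0$ for $i\ne j$. Its *discrete Lamé coefficients* are functions $h_i=h_i^+$ and $h_i^-$ with $$\langle X_i,X_i\rangle=2(T_ih_i^+)h_i^-,\quad \langle X_i,X_i^-\rangle=-(T_ih_i^+)(T_i^-h_i^-),\quad \langle T_jX_i,X_i^-\rangle=-(T_iT_jh_i^+)(T_i^-h_i^-)\ (i\ne j)$$ (they are determined up to $h_i^\pm\mapsto a_i^{\pm1}h_i^\pm$, $a_i$ nonzero constants), and $\beta_{ij}=\Delta_ih_j/T_ih_i$,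 $i\neq j$, are its *rotation coefficients*; these are called *normalized* if $h_i^+(0)=1$ for all $i$. For functions $\beta_{ij}:\mathbb Z^n\to\Bbbk$, $i\neq j$, consider, for pairwise distinct indices, the relations $$(T_k\beta_{ik})(T_i\beta_{ji})(T_j\beta_{kj})=(T_k\beta_{jk})(T_j\beta_{ij})(T_i\beta_{ki})\tag{1}$$ and the discrete Lamé equations $$\Delta_k\beta_{ij}=(T_k\beta_{ik})\beta_{kj},\qquad \Delta_jv_i=\Delta_i(\beta_{ji}T_j\beta_{ij}),$$ $$\Delta_i\Delta_j\beta_{ij}+\Delta_i\beta_{ij}+\Delta_j\beta_{ij}=T_j\beta_{ij}\,(T_jv_i-v_j)-\sum_{k\ne i,j}T_j(\beta_{ik}\beta_{kj}),\tag{2}$$ where $v_i=-\sum_{p\ne i}\beta_{ip}(T_i\beta_{pi})$. Put $p_{ij}=(T_j\beta_{ij})(T_i\beta_{ji})$, and for $\zeta\in\Bbbk\setminus\{0\}$ let $\beta^{\zeta}_{ij}(u)=(2\zeta)^{u_j-u_i-1}\beta_{ij}(u)$. **Sufficiency.** Let $\beta_{ij}$ satisfy (1) and (2), and assume that everywhere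 on $\mathbb Z^n$ and for all $i\ne j$: if $\Bbbk=\mathbb C$, $\beta_{ij}\ne0$ and $p_{ij}\neq 1$; if $\Bbbk=\mathbb R$, $0<p_{ij}<1$. Then there is a constant $\eta\in\Bbbk\setminus\{0\}$, unique up to sign, such that $\beta^{\eta}_{ij}$ are rotation coefficients of some Darboux–Egoroff lattice in $\Bbbk^n$: for $\zeta\neq0$ the functions $\beta^{\zeta}_{ij}$ are such coefficients if and only if $\zeta=\pm\eta$. Moreover, $\beta^\zeta_{ij}$ are normalized rotation coefficients of some Darboux–Egoroff lattice in $\Bbbk^n$ if and only if $\zeta=\pm\eta$ and $\sum_{k\in S}\beta_{kj}\bigl(-\sum_{k\in S}e_k\bigr)\ne1$ for all $S\subset\{1,\dots,n\}$ and $j\notin S$. **Necessity.** If, for some $\zeta\in\Bbbk\setminus\{0\}$, the functions $\beta^\zeta_{ij}$ are rotation coefficients of some Darboux–Egoroff lattice in $\Bbbk^n$, then $\beta_{ij}$ satisfy (1) and (2), and $p_{ij}\ne1$ everywhere if $\Bbbk=\mathbb C$, $0\le p_{ij}<1$ everywhere if $\Bbbk=\mathbb R$. -/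

import Mathlib

open Finset

namespace DarbouxEgoroff

/-- The point `u + e_i` of the integer lattice. -/
def up {n : ℕ} (i : Fin n) (u : Fin n → ℤ) : Fin n → ℤ := u + Pi.single i 1

/-- The point `u - e_i` of the integer lattice. -/
def down {n : ℕ} (i : Fin n) (u : Fin n → ℤ) : Fin n → ℤ := u - Pi.single i 1

/-- The shift operator `(T_i F)(u) = F(u + e_i)`. -/
def T {n : ℕ} {A : Type*} (i : Fin n) (F : (Fin n → ℤ) → A) : (Fin n → ℤ) → A :=
  fun u => F (up i u)

/-- The discrete derivative `Δ_i F = T_i F - F`. -/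
def Δ {n : ℕ} {A : Type*} [Sub A] (i : Fin n) (F : (Fin n → ℤ) → A) : (Fin n → ℤ) → A :=
  fun u => T i F u - F u

section Lattice

variable {𝕜 : Type*} [Field 𝕜] {n : ℕ}

/-- The edge `X_i^+(u) = x(u + e_i) - x(u)`. -/
def edge (x : (Fin n → ℤ) → Fin n → 𝕜) (i : Fin n) : (Fin n → ℤ) → Fin n → 𝕜 :=
  fun u => x (up i u) - x u

/-- The edge `X_i^-(u) = x(u - e_i) - x(u)`. -/
def edgeNeg (x : (Fin n → ℤ) → Fin n → 𝕜) (i : Fin n) : (Fin n → ℤ) → Fin n → 𝕜 :=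
  fun u => x (down i u) - x u

/-- Darboux-Egoroff lattices in `𝕜ⁿ`, where `𝕜ⁿ` carries the bilinear scalar product
`∑ k, a k * b k` (for `𝕜 = ℝ` this is the Euclidean scalar product): nondegenerate planar
lattices with `⟨X_i^+, X_j^-⟩ = 0` for `i ≠ j`. -/
structure IsLattice (x : (Fin n → ℤ) → Fin n → 𝕜) : Prop where
  nondegenerate : ∀ u, LinearIndependent 𝕜 (fun i => edge x i u)
  planar : ∀ i j, i ≠ j → ∀ u,
    Coplanar 𝕜 ({x u, x (up i u), x (up j u), x (up i (up j u))} : Set (Fin n → 𝕜))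
  orthogonal : ∀ i j, i ≠ j → ∀ u, edge x i u ⬝ᵥ edgeNeg x j u = 0

/-- `hp = h⁺` and `hm = h⁻` are discrete Lamé coefficients of the lattice `x`. They are unique up to
`h_i^± ↦ a_i^{±1} h_i^±` with nonzero constants `a_i`. -/
structure IsLameCoefficients (x : (Fin n → ℤ) → Fin n → 𝕜)
    (hp hm : Fin n → (Fin n → ℤ) → 𝕜) : Prop where
  edge_edge : ∀ i u, edge x i u ⬝ᵥ edge x i u = 2 * hp i (up i u) * hm i u
  edge_edgeNeg : ∀ i u, edge x i u ⬝ᵥ edgeNeg x i u = -(hp i (up i u) * hm i (down i u))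
  shift_edge_edgeNeg : ∀ i j, i ≠ j → ∀ u,
    edge x i (up j u) ⬝ᵥ edgeNeg x i u = -(hp i (up i (up j u)) * hm i (down i u))

/-- The `β_ij`, `i ≠ j`, are the rotation coefficients `β_ij = Δ_i h_j / T_i h_i` of some
Darboux-Egoroff lattice, for some choice of its discrete Lamé coefficients. Here and below the
diagonal entries of `β` play no role. -/
def IsRotationCoefficients (β : Fin n → Fin n → (Fin n → ℤ) → 𝕜) : Prop :=
  ∃ (x : (Fin n → ℤ) → Fin n → 𝕜) (hp hm : Fin n → (Fin n → ℤ) → 𝕜),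
    IsLattice x ∧ IsLameCoefficients x hp hm ∧
      ∀ i j, i ≠ j → ∀ u, β i j u = Δ i (hp j) u / T i (hp i) u

/-- The same with the discrete Lamé coefficients normalized by `h_i^+(0) = 1`. -/
def IsNormalizedRotationCoefficients (β : Fin n → Fin n → (Fin n → ℤ) → 𝕜) : Prop :=
  ∃ (x : (Fin n → ℤ) → Fin n → 𝕜) (hp hm : Fin n → (Fin n → ℤ) → 𝕜),
    IsLattice x ∧ IsLameCoefficients x hp hm ∧ (∀ i, hp i 0 = 1) ∧
      ∀ i j, i ≠ j → ∀ u, β i j u = Δ i (hp j) u / T i (hp i) u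

end Lattice

section Equations

variable {𝕜 : Type*} [Field 𝕜] {n : ℕ}

/-- `(T_k β_ik)(T_i β_ji)(T_j β_kj) = (T_k β_jk)(T_j β_ij)(T_i β_ki)` for distinct `i, j, k`. -/
def TripleProduct (β : Fin n → Fin n → (Fin n → ℤ) → 𝕜) : Prop :=
  ∀ i j k, i ≠ j → j ≠ k → i ≠ k → ∀ u,
    T k (β i k) u * T i (β j i) u * T j (β k j) u
      = T k (β j k) u * T j (β i j) u * T i (β k i) u

/-- `v_i = - ∑_{p ≠ i} β_ip (T_i β_pi)`. -/
def v (β : Fin n → Fin n → (Fin n → ℤ) → 𝕜) (i : Fin n) : (Fin n → ℤ) → 𝕜 :=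
  fun u => -∑ p ∈ univ.filter (fun p => p ≠ i), β i p u * T i (β p i) u

/-- The discrete Lamé equations. -/
structure LameEquations (β : Fin n → Fin n → (Fin n → ℤ) → 𝕜) : Prop where
  eq₁ : ∀ i j k, i ≠ j → j ≠ k → i ≠ k → ∀ u, Δ k (β i j) u = T k (β i k) u * β k j u
  eq₂ : ∀ i j, i ≠ j → ∀ u, Δ j (v β i) u = Δ i (fun w => β j i w * T j (β i j) w) u
  eq₃ : ∀ i j, i ≠ j → ∀ u,
    Δ i (Δ j (β i j)) u + Δ i (β i j) u + Δ j (β i j) u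
      = T j (β i j) u * (T j (v β i) u - v β j u)
        - ∑ k ∈ univ.filter (fun k => k ≠ i ∧ k ≠ j), T j (fun w => β i k w * β k j w) u

/-- The gauge transformation `β_ij(u) ↦ (2η)^(u_j - u_i - 1) β_ij(u)`. -/
def gauge (η : 𝕜) (β : Fin n → Fin n → (Fin n → ℤ) → 𝕜) : Fin n → Fin n → (Fin n → ℤ) → 𝕜 :=
  fun i j u => (2 * η) ^ (u j - u i - 1) * β i j u

/-- The gauge-invariant quantity `(T_j β_ij)(T_i β_ji)`. -/
def pairProduct (β : Fin n → Fin n → (Fin n → ℤ) → 𝕜) (i j : Fin n) : (Fin n → ℤ) → 𝕜 :=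
  fun u => T j (β i j) u * T i (β j i) u

/-- The point `-∑_{k ∈ S} e_k`. -/
def corner (S : Finset (Fin n)) : Fin n → ℤ := fun k => if k ∈ S then -1 else 0

/-- The normalization `h_i^+(0) = 1` forces `h_j^+(-∑_{k ∈ S} e_k) = 1 - ∑_{k ∈ S} β_kj(-∑_{k ∈ S} e_k)`
for `j ∉ S`; this is the condition that none of these numbers vanishes. -/
def AdmitsNormalization (β : Fin n → Fin n → (Fin n → ℤ) → 𝕜) : Prop :=
  ∀ (S : Finset (Fin n)) (j : Fin n), j ∉ S → ∑ k ∈ S, β k j (corner S) ≠ 1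

end Equations

end DarbouxEgoroff

open DarbouxEgoroff

/-! Divide each edge `X_i` by `2ζ T_i H_i`, where `h_i⁺ = (2ζ)^(u_i) H_i`. The resulting vectors
`Z_i` satisfy `T_j Z_i = Z_i + (T_j β_ij) Z_j` and `T_i Z_i = (ζ + v_i) Z_i - ∑ β_ij Z_j`, and they
encode the lattice: `Z` carries the metric information, `H` the scaling of the edges. The Lamé
equations (2) are exactly the compatibility of this linear system, whatever the value of `ζ`
(`LameEquations.waveMatrix_compat`, `LameEquations.of_waveMatrix_compat`).

Orthogonality forces the Gram matrix of the `Z_i` to be determined by `β` and the squared lengths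
`γ_i`. The `γ_i` satisfy an overdetermined multiplicative system, whose compatibility comes from (1)
and (2) (`exists_isMetric`). Transport of the Gram matrix in direction `i` by the linear system is
automatically correct except in the entry `(i, i)`, where the error is `(σ_i - ζ²) γ_i`
(`IsMetric.gram_up`). Transporting around an elementary square shows that `σ_i` depends neither on
`i` nor on the point (`IsMetric.spectral_eq`), and it is nonzero because the Gram matrix is
nondegenerate. Hence the admissible `ζ` are the two square roots of one constant. A lattice step
Schur-complements the Gram matrix, so its pivots are values of `γ`; over `ℂ`, or over `ℝ` with `γ >
0`, it factors as `M Mᵀ`, which gives initial values for `Z` (`IsMetric.exists_factorization`).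

What remains is a nowhere vanishing solution `H` of the linear system `Δ_i h_k = β_ik T_i h_i`. It
has many solutions supported in half-spaces, which form a locally finite family; a generic infinite
combination of them vanishes nowhere, since only countably many linear conditions have to be
avoided. With `h_i(0)` prescribed, the values at the points `corner S` in the components outside `S`
are the ones that cannot be adjusted, which is the origin of the normalization condition
(`exists_nonvanishing_solution`).

Conversely, `IsLattice.exists_wave` recovers `Z`, `H` and `γ` from any lattice, so (1), (2) and the
inequalities can be read off from a Gram matrix and a compatible linear system. -/

namespace DarbouxEgoroff

/-! ### Difference equations and closed one-forms on the integer lattice. -/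

section Lattice

variable {n : ℕ}

theorem up_comm (i j : Fin n) (u : Fin n → ℤ) : up i (up j u) = up j (up i u) := by
  simp only [up]; abel

@[simp] theorem up_down (i : Fin n) (u : Fin n → ℤ) : up i (down i u) = u := by
  simp [up, down]

@[simp] theorem down_up (i : Fin n) (u : Fin n → ℤ) : down i (up i u) = u := by
  simp [up, down]

@[simp] theorem up_self (i : Fin n) (u : Fin n → ℤ) : up i u i = u i + 1 := by
  simp [up]

theorem up_of_ne {i j : Fin n} (h : j ≠ i) (u : Fin n → ℤ) : up i u j = u j := by
  simp [up, h]

@[simp] theorem down_self (i : Fin n) (u : Fin n → ℤ) : down i u i = u i - 1 := by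
  simp [down]

/-- A property of lattice points that is invariant under unit steps and holds at the origin
holds everywhere. -/
theorem lattice_induction {P : (Fin n → ℤ) → Prop} (h0 : P 0)
    (hstep : ∀ i u, P u ↔ P (up i u)) (u : Fin n → ℤ) : P u := by
  have line : ∀ (i : Fin n) (m : ℤ) (w : Fin n → ℤ), P w → P (w + Pi.single i m) := by
    intro i m
    induction m using Int.induction_on with
    | zero => intro w hw; simpa using hw
    | succ k ih =>
      intro w hw
      have := (hstep i _).1 (ih w hw)
      rwa [up, add_assoc, ← Pi.single_add] at this
    | pred k ih =>
      intro w hw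
      refine (hstep i _).2 ?_
      rw [up, add_assoc, ← Pi.single_add]
      simpa using ih w hw
  have key : ∀ s : Finset (Fin n), P (∑ i ∈ s, Pi.single i (u i)) := by
    intro s
    induction s using Finset.induction_on with
    | empty => simpa using h0
    | insert i s hi ih =>
      rw [Finset.sum_insert hi, add_comm]
      exact line i _ _ ih
  have := key univ
  rwa [Finset.univ_sum_single] at this

variable {Γ : Type*} [Group Γ]

theorem exists_line (a : ℤ → Γ) : ∃ l : ℤ → Γ, l 0 = 1 ∧ ∀ m, l (m + 1) = a m * l m := by
  refine ⟨fun m => Int.rec (fun k => Nat.rec 1 (fun p g => a p * g) k)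
    (fun k => Nat.rec ((a (-1))⁻¹) (fun p g => (a (-(p : ℤ) - 2))⁻¹ * g) k) m, rfl, ?_⟩
  intro m
  rcases m with k | k
  · rfl
  · rcases k with _ | k
    · change (1 : Γ) = a (-1) * (a (-1))⁻¹
      simp
    · have h1 : Int.negSucc (k + 1) + 1 = Int.negSucc k := by omega
      have h2 : Int.negSucc (k + 1) = -(k : ℤ) - 2 := by omega
      rw [h1]
      change _ = a (Int.negSucc (k + 1)) * ((a (-(k : ℤ) - 2))⁻¹ * _)
      rw [h2]
      simp

/-- A compatible system of first order multiplicative difference equations on `ℤⁿ` is solvable. -/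
theorem exists_path (A : Fin n → (Fin n → ℤ) → Γ)
    (hA : ∀ i j, i ≠ j → ∀ u, A j (up i u) * A i u = A i (up j u) * A j u) :
    ∃ Φ : (Fin n → ℤ) → Γ, Φ 0 = 1 ∧ ∀ i u, Φ (up i u) = A i u * Φ u := by
  -- Solve on the sublattice spanned by the directions in `s`; a new direction `i` is added by
  -- integrating along the lines parallel to `e_i`.
  suffices key : ∀ s : Finset (Fin n), ∃ Φ : (Fin n → ℤ) → Γ, Φ 0 = 1 ∧
      ∀ i ∈ s, ∀ u : Fin n → ℤ, (∀ k ∉ s, u k = 0) → Φ (up i u) = A i u * Φ u by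
    obtain ⟨Φ, h0, h⟩ := key univ
    exact ⟨Φ, h0, fun i u => h i (mem_univ _) u (by simp)⟩
  intro s
  induction s using Finset.induction_on with
  | empty => exact ⟨fun _ => 1, rfl, by simp⟩
  | insert i s hi ih =>
    obtain ⟨Φ, h0, hΦ⟩ := ih
    choose l l0 hl using fun u : Fin n → ℤ => exists_line (fun m => A i (Function.update u i m))
    have lcongr : ∀ u w : Fin n → ℤ, (∀ k, k ≠ i → u k = w k) → ∀ m, l u m = l w m := by
      intro u w huw
      have e : ∀ m, Function.update u i m = Function.update w i m := by
        intro m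
        ext k
        by_cases hk : k = i
        · subst hk; simp
        · simp [hk, huw k hk]
      intro m
      induction m using Int.induction_on with
      | zero => rw [l0, l0]
      | succ k ih => rw [hl, hl, ih, e]
      | pred k ih =>
        have h1 := hl u (-(k : ℤ) - 1)
        have h2 := hl w (-(k : ℤ) - 1)
        rw [sub_add_cancel] at h1 h2
        rw [h1, h2, e] at ih
        exact mul_left_cancel ih
    refine ⟨fun u => l u (u i) * Φ (Function.update u i 0), ?_, ?_⟩
    · have : Function.update (0 : Fin n → ℤ) i 0 = 0 := by ext; simp
      simp [this, l0, h0]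
    · intro j hj u hu
      rcases Finset.mem_insert.1 hj with rfl | hj
      · have e1 : Function.update (up j u) j 0 = Function.update u j 0 := by
          ext k; by_cases hk : k = j
          · subst hk; simp
          · simp [hk, up_of_ne hk]
        simp only [e1, up_self]
        rw [lcongr (up j u) u (fun k hk => up_of_ne hk u), hl]
        simp [mul_assoc]
      · have hji : j ≠ i := fun h => hi (h ▸ hj)
        have e0 : ∀ m, Function.update (up j u) i m = up j (Function.update u i m) := by
          intro m
          ext k; by_cases hk : k = i
          · subst hk; simp [up_of_ne (Ne.symm hji)]
          · by_cases hkj : k = j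
            · subst hkj; simp [hk]
            · simp [hk, hkj, up_of_ne]
        -- Transport along an `i`-line commutes with the step in direction `j`: the compatibility
        -- squares are stacked along the line.
        have key : ∀ m, l (up j u) m * A j (Function.update u i 0)
            = A j (Function.update u i m) * l u m := by
          have step : ∀ m, A i (up j (Function.update u i m)) * A j (Function.update u i m)
              = A j (Function.update u i (m + 1)) * A i (Function.update u i m) := by
            intro m
            rw [← hA i j (Ne.symm hji)]
            congr 2
            ext k; by_cases hk : k = i
            · subst hk; simp
            · simp [hk, up_of_ne]
          intro m
          induction m using Int.induction_on with
          | zero => simp [l0]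
          | succ k ih =>
            rw [hl, hl, mul_assoc, ih, e0, ← mul_assoc, step, mul_assoc]
          | pred k ih =>
            have h1 := hl u (-(k : ℤ) - 1)
            have h2 := hl (up j u) (-(k : ℤ) - 1)
            have h3 := step (-(k : ℤ) - 1)
            rw [sub_add_cancel] at h1 h2 h3
            rw [h1, h2, ← mul_assoc, ← h3, e0, mul_assoc, mul_assoc] at ih
            exact mul_left_cancel ih
        simp only [e0, up_of_ne (Ne.symm hji)]
        rw [hΦ j hj _ ?_, ← mul_assoc, key, Function.update_eq_self, mul_assoc]
        intro k hk
        by_cases hki : k = i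
        · subst hki; simp
        · rw [Function.update_of_ne hki]
          exact hu k (by simp [hki, hk])

/-- Discrete closed one-forms on `ℤⁿ` are exact. -/
theorem exists_potential {V : Type*} [AddCommGroup V] (f : Fin n → (Fin n → ℤ) → V)
    (hf : ∀ i j, i ≠ j → ∀ u, f j (up i u) + f i u = f i (up j u) + f j u) (c : V) :
    ∃ w : (Fin n → ℤ) → V, w 0 = c ∧ ∀ i u, w (up i u) = w u + f i u := by
  obtain ⟨Φ, h0, hΦ⟩ := exists_path (Γ := Multiplicative V)
    (fun i u => Multiplicative.ofAdd (f i u)) (fun i j hij u => by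
      rw [← ofAdd_add, ← ofAdd_add, hf i j hij u])
  refine ⟨fun u => (Φ u).toAdd + c, by simp [h0], fun i u => ?_⟩
  simp only [hΦ, toAdd_mul, toAdd_ofAdd]
  abel

/-- Closed one-forms on a coordinate hyperplane are exact. -/
theorem exists_potential_slab {V : Type*} [AddCommGroup V] (j : Fin n) (m : ℤ)
    (f : Fin n → (Fin n → ℤ) → V)
    (hf : ∀ i k, i ≠ j → k ≠ j → i ≠ k → ∀ u : Fin n → ℤ, u j = m →
      f k (up i u) + f i u = f i (up k u) + f k u) :
    ∃ w : (Fin n → ℤ) → V, ∀ i, i ≠ j → ∀ u : Fin n → ℤ, u j = m → w (up i u) = w u + f i u := by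
  have e : ∀ (i : Fin n) (u : Fin n → ℤ), i ≠ j →
      Function.update (up i u) j m = up i (Function.update u j m) := by
    intro i u hij
    ext k; by_cases hk : k = j
    · subst hk; simp [up_of_ne (Ne.symm hij)]
    · by_cases hki : k = i
      · subst hki; simp [hk]
      · simp [hk, hki, up_of_ne]
  have ej : ∀ u : Fin n → ℤ, Function.update (up j u) j m = Function.update u j m := by
    intro u
    ext k; by_cases hk : k = j
    · subst hk; simp
    · simp [hk, up_of_ne]
  -- The form is extended off the hyperplane as constant in direction `j` with zero `j`-component,
  -- which keeps it closed.
  obtain ⟨w, -, hw⟩ := exists_potential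
    (fun i u => if i = j then 0 else f i (Function.update u j m)) (by
      intro i k hik u
      by_cases hi : i = j
      · subst hi; simp [Ne.symm hik, ej]
      · by_cases hk : k = j
        · subst hk; simp [hi, ej]
        · simp only [hi, hk, if_false, e i u hi, e k u hk]
          exact hf i k hi hk hik _ (by simp)) 0
  refine ⟨w, fun i hi u hu => ?_⟩
  rw [hw, if_neg hi, ← hu, Function.update_eq_self]

end Lattice

/-! ### Squared lengths determined by the rotation coefficients. -/

section Metric

variable {𝕜 : Type*} [Field 𝕜] {n : ℕ} {β : Fin n → Fin n → (Fin n → ℤ) → 𝕜}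

theorem LameEquations.shift (hL : LameEquations β) {i j k : Fin n} (hij : i ≠ j) (hjk : j ≠ k)
    (hik : i ≠ k) (u : Fin n → ℤ) :
    β i j (up k u) = β i j u + β i k (up k u) * β k j u := by
  have := hL.eq₁ i j k hij hjk hik u
  simp only [Δ, T] at this
  linear_combination this

/-- The two instances of `shift` for `β i j` and `β i k` at the far corner of the square involve
each other; eliminating `T_j T_k β_ik` leaves this. -/
theorem LameEquations.shift_shift (hL : LameEquations β) {i j k : Fin n} (hij : i ≠ j)
    (hjk : j ≠ k) (hik : i ≠ k) (u : Fin n → ℤ) :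
    β i j (up j (up k u)) * (1 - pairProduct β j k u)
      = β i j (up j u) + β i k (up k u) * β k j (up j u) := by
  have h1 := hL.shift hij hjk hik (up j u)
  have h2 := hL.shift hik hjk.symm hij (up k u)
  rw [up_comm j k] at *
  simp only [pairProduct, T]
  linear_combination h1 + β k j (up j u) * h2

theorem pairProduct_symm (i j : Fin n) (u : Fin n → ℤ) :
    pairProduct β i j u = pairProduct β j i u := by
  simp only [pairProduct, T]; ring

theorem TripleProduct.apply (hT : TripleProduct β) {i j k : Fin n} (hij : i ≠ j)
    (hjk : j ≠ k) (hik : i ≠ k) (u : Fin n → ℤ) :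
    β i k (up k u) * β j i (up i u) * β k j (up j u)
      = β j k (up k u) * β i j (up j u) * β k i (up i u) :=
  hT i j k hij hjk hik u

/-- The expansion of a `3 × 3` principal minor of the Gram matrix, in units of its diagonal. -/
theorem LameEquations.pairProduct_minor (hL : LameEquations β) (hT : TripleProduct β)
    {i j k : Fin n} (hij : i ≠ j) (hjk : j ≠ k) (hik : i ≠ k) (u : Fin n → ℤ) :
    (1 - pairProduct β i j (up k u)) * (1 - pairProduct β j k u) * (1 - pairProduct β i k u) =
      1 - pairProduct β i j u - pairProduct β j k u - pairProduct β i k u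
        - 2 * (β i k (up k u) * β j i (up i u) * β k j (up j u)) := by
  have h1 := hL.shift_shift hij hjk hik u
  have h2 := hL.shift_shift hij.symm hik hjk u
  have h3 := hT.apply hij hjk hik u
  simp only [pairProduct, T] at *
  linear_combination (-(β j i (up i (up k u)) * (1 - β i k (up k u) * β k i (up i u)))) * h1
    - (β i j (up j u) + β i k (up k u) * β k j (up j u)) * h2 + h3

/-- The squared lengths of the vectors spanning the edges of a Darboux-Egoroff lattice, as
determined by its rotation coefficients. -/
structure IsMetric (β : Fin n → Fin n → (Fin n → ℤ) → 𝕜) (γ : Fin n → (Fin n → ℤ) → 𝕜) :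
    Prop where
  ne_zero : ∀ i u, γ i u ≠ 0
  symm : ∀ i j, i ≠ j → ∀ u, β j i (up i u) * γ i u = β i j (up j u) * γ j u
  shift : ∀ i j, i ≠ j → ∀ u, γ i (up j u) = γ i u * (1 - pairProduct β i j u)

/-- The ratio of `γ i` and `γ j`. -/
def ratio (β : Fin n → Fin n → (Fin n → ℤ) → 𝕜) (i j : Fin n) : (Fin n → ℤ) → 𝕜 :=
  fun u => if i = j then 1 else β i j (up j u) / β j i (up i u)

theorem ratio_self (i : Fin n) (u : Fin n → ℤ) : ratio β i i u = 1 := if_pos rfl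

theorem ratio_ne_zero (hβ : ∀ i j, i ≠ j → ∀ u, β i j u ≠ 0) (i j : Fin n) (u : Fin n → ℤ) :
    ratio β i j u ≠ 0 := by
  unfold ratio
  split_ifs with h
  · exact one_ne_zero
  · exact div_ne_zero (hβ i j h _) (hβ j i (Ne.symm h) _)

/-- The cocycle property of the ratios is relation (1). -/
theorem ratio_mul (hβ : ∀ i j, i ≠ j → ∀ u, β i j u ≠ 0) (hT : TripleProduct β)
    (i j k : Fin n) (u : Fin n → ℤ) : ratio β i j u * ratio β j k u = ratio β i k u := by
  by_cases hij : i = j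
  · subst hij; simp [ratio_self]
  by_cases hjk : j = k
  · subst hjk; simp [ratio_self]
  by_cases hik : i = k
  · subst hik
    simp only [ratio, if_neg hij, if_neg hjk, if_true]
    have := hβ i j hij (up j u)
    have := hβ j i hjk (up i u)
    field_simp
  simp only [ratio, if_neg hij, if_neg hjk, if_neg hik]
  have h1 := hβ j i (Ne.symm hij) (up i u)
  have h2 := hβ k j (Ne.symm hjk) (up j u)
  have h3 := hβ k i (Ne.symm hik) (up i u)
  rw [div_mul_div_comm, div_eq_div_iff (mul_ne_zero h1 h2) h3]
  linear_combination - hT.apply hij hjk hik u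

/-- This is consistency of the prescribed ratio `γ_i / γ_j` with the prescribed growth of both
lengths in a third direction. -/
theorem ratio_shift (hβ : ∀ i j, i ≠ j → ∀ u, β i j u ≠ 0)
    (hp : ∀ i j, i ≠ j → ∀ u, pairProduct β i j u ≠ 1) (hT : TripleProduct β)
    (hL : LameEquations β) {i j k : Fin n} (hjk : j ≠ k) (hik : i ≠ k) (u : Fin n → ℤ) :
    ratio β i j (up k u) * (1 - pairProduct β j k u)
      = ratio β i j u * (1 - pairProduct β i k u) := by
  by_cases hij : i = j
  · subst hij; simp [ratio_self]
  simp only [ratio, if_neg hij]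
  have h1 := hL.shift_shift hij hjk hik u
  have h2 := hL.shift_shift (Ne.symm hij) hik hjk u
  have h3 := hT.apply hij hjk hik u
  have n1 := hβ j i (Ne.symm hij) (up i u)
  have n2 := hβ j i (Ne.symm hij) (up i (up k u))
  have n3 : 1 - pairProduct β i k u ≠ 0 := sub_ne_zero.2 (hp i k hik u).symm
  rw [div_mul_eq_mul_div, div_mul_eq_mul_div, div_eq_div_iff n2 n1, h1]
  linear_combination h3 - β i j (up j u) * h2

/-- All lengths are multiples of one of them, `γ_o`, so only a scalar system for `γ_o` has to be
integrated. Its growth in direction `o` is not prescribed directly and is obtained through another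
index; a third index is needed to see that this choice does not matter and that the system is
compatible. -/
theorem exists_isMetric (hn : 3 ≤ n) (hβ : ∀ i j, i ≠ j → ∀ u, β i j u ≠ 0)
    (hp : ∀ i j, i ≠ j → ∀ u, pairProduct β i j u ≠ 1) (hT : TripleProduct β)
    (hL : LameEquations β) : ∃ γ, IsMetric β γ ∧ ∃ i, γ i 0 = 1 := by
  have np : ∀ i j, i ≠ j → ∀ u, 1 - pairProduct β i j u ≠ 0 :=
    fun i j hij u => sub_ne_zero.2 (hp i j hij u).symm
  have nr := ratio_ne_zero hβ
  have rmul := ratio_mul hβ hT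
  have rinv : ∀ i j u, ratio β i j u * ratio β j i u = 1 := fun i j u => by
    rw [rmul, ratio_self]
  have third : ∀ i j : Fin n, ∃ k, k ≠ i ∧ k ≠ j := fun i j => by
    have : ({i, j} : Finset (Fin n)).card < Fintype.card (Fin n) := by
      rw [Fintype.card_fin]
      exact lt_of_le_of_lt Finset.card_le_two (by omega)
    obtain ⟨k, hk⟩ := Finset.exists_mem_notMem_of_card_lt_card
      (s := {i, j}) (t := univ) (by simpa using this)
    exact ⟨k, by simpa [not_or] using hk⟩
  let o : Fin n := ⟨0, by omega⟩
  obtain ⟨a, hao, -⟩ := third o o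
  -- `m i` is the factor `γ_o(u + e_i) / γ_o(u)`. For `i = o` it comes from passing to `γ_a`,
  -- stepping, and passing back.
  let m : Fin n → (Fin n → ℤ) → 𝕜 := fun i u =>
    if i = o then ratio β o a (up o u) * (1 - pairProduct β o a u) * ratio β a o u
    else 1 - pairProduct β o i u
  have m_ne : ∀ i, i ≠ o → ∀ u, m i u = 1 - pairProduct β o i u := fun i hi u => if_neg hi
  have m_o : ∀ b, b ≠ o → ∀ u,
      m o u = ratio β o b (up o u) * (1 - pairProduct β o b u) * ratio β b o u := by
    intro b hb u
    by_cases hab : a = b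
    · subst hab; simp [m]
    have h := ratio_shift hβ hp hT hL (i := a) (j := b) hb hao u
    simp only [m, if_true]
    rw [← rmul o a b (up o u), ← rmul b a o u, pairProduct_symm o a, pairProduct_symm o b]
    have h2 := rinv a b u
    linear_combination (- ratio β o a (up o u) * ratio β b a u * ratio β a o u) * h
      - ratio β o a (up o u) * ratio β a o u * (1 - pairProduct β a o u) * h2
  have m_nz : ∀ i u, m i u ≠ 0 := by
    intro i u
    by_cases hi : i = o
    · subst hi
      exact (m_o a hao u) ▸ mul_ne_zero (mul_ne_zero (nr _ _ _) (np _ _ hao.symm _)) (nr _ _ _)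
    · rw [m_ne i hi]; exact np _ _ (Ne.symm hi) _
  have compat_o : ∀ k, k ≠ o → ∀ u, m k (up o u) * m o u = m o (up k u) * m k u := by
    intro k hk u
    obtain ⟨j, hjo, hjk⟩ := third o k
    rw [m_ne k hk, m_ne k hk, m_o j hjo, m_o j hjo, up_comm o k]
    have h1 := ratio_shift hβ hp hT hL (i := o) (j := j) hjk hk.symm (up o u)
    have h2 := ratio_shift hβ hp hT hL (i := j) (j := o) hk.symm hjk u
    have h3 := hL.pairProduct_minor hT hjo.symm hjk hk.symm u
    have h4 := hL.pairProduct_minor hT hjk hk hjo u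
    have h5 := hT.apply hjo.symm hjk hk.symm u
    have n1 := np j k hjk u
    have n2 := np j k hjk (up o u)
    have n3 := np o k hk.symm u
    refine mul_right_cancel₀ n1 (mul_right_cancel₀ n2 (mul_right_cancel₀ n3 ?_))
    rw [pairProduct_symm k o, pairProduct_symm j o] at h4
    -- Both sides, multiplied by `1 - p_ok`, are the same `3 × 3` minor, expanded along different
    -- edges.
    have h6 : (1 - pairProduct β j k (up o u)) * (1 - pairProduct β o j u)
        = (1 - pairProduct β o j (up k u)) * (1 - pairProduct β j k u) := by
      refine mul_right_cancel₀ n3 ?_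
      linear_combination h4 - h3
    linear_combination (-ratio β j o (up k u) * (1 - pairProduct β o j (up k u))
        * (1 - pairProduct β o k u) * (1 - pairProduct β o k u) * (1 - pairProduct β j k u)) * h1
      - ratio β o j (up o u) * (1 - pairProduct β o k (up o u)) * (1 - pairProduct β o k u)
        * (1 - pairProduct β j k u) * (1 - pairProduct β o j (up k u)) * h2
      + ratio β o j (up o u) * ratio β j o u * (1 - pairProduct β o k (up o u))
        * (1 - pairProduct β o k u) * (1 - pairProduct β j k u) * h6
  have compat : ∀ i j, i ≠ j → ∀ u, m j (up i u) * m i u = m i (up j u) * m j u := by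
    intro i j hij u
    by_cases hi : i = o
    · subst hi; exact compat_o j (Ne.symm hij) u
    by_cases hj : j = o
    · subst hj; exact (compat_o i hij u).symm
    rw [m_ne i hi, m_ne i hi, m_ne j hj, m_ne j hj]
    have h3 := hL.pairProduct_minor hT (Ne.symm hi) hij (Ne.symm hj) u
    have h4 := hL.pairProduct_minor hT (Ne.symm hj) (Ne.symm hij) (Ne.symm hi) u
    have h5 := hT.apply (Ne.symm hi) hij (Ne.symm hj) u
    rw [pairProduct_symm j i] at h4
    -- After multiplication by `1 - p_ij` both sides become the principal minor on `o, i, j`, which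
    -- is symmetric by (1).
    refine mul_right_cancel₀ (np i j hij u) ?_
    linear_combination h4 - h3 + 2 * h5
  obtain ⟨Φ, Φ0, hΦ⟩ := exists_path (Γ := 𝕜ˣ) (fun i u => Units.mk0 (m i u) (m_nz i u))
    (fun i j hij u => by ext; simpa using compat i j hij u)
  have hΦ' : ∀ i u, (Φ (up i u) : 𝕜) = m i u * Φ u := fun i u => by simp [hΦ]
  refine ⟨fun i u => ratio β i o u * Φ u, ⟨fun i u => mul_ne_zero (nr _ _ _) (Φ u).ne_zero,
    fun i j hij u => ?_, fun i j hij u => ?_⟩, o, by simp [ratio_self, Φ0]⟩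
  · rw [← rmul i j o]
    have n1 := hβ j i (Ne.symm hij) (up i u)
    simp only [ratio, if_neg hij]
    field_simp
  · rw [hΦ']
    by_cases hj : j = o
    · subst hj
      rw [m_o i hij, pairProduct_symm i]
      linear_combination ratio β i o u * (1 - pairProduct β o i u) * Φ u * rinv i o (up o u)
    · rw [m_ne j hj]
      have h := ratio_shift hβ hp hT hL (i := i) (j := o) (Ne.symm hj) hij u
      linear_combination Φ u * h

/-- Since `p_ij > 0`, all `γ_i` at one point have the same sign. A step in direction `k` preserves
the sign of every `γ_l` with `l ≠ k`, hence the common sign. -/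
theorem IsMetric.pos {β : Fin n → Fin n → (Fin n → ℤ) → ℝ}
    {γ : Fin n → (Fin n → ℤ) → ℝ} (hγ : IsMetric β γ) (hn : 3 ≤ n)
    (hp : ∀ i j, i ≠ j → ∀ u, 0 < pairProduct β i j u ∧ pairProduct β i j u < 1)
    (h0 : ∃ i, γ i 0 = 1) (i : Fin n) (u : Fin n → ℤ) : 0 < γ i u := by
  have sign : ∀ i j u, 0 < γ i u → 0 < γ j u := by
    intro i j u h
    by_cases hij : i = j
    · exact hij ▸ h
    have h1 := hγ.symm i j hij u
    have h2 := (hp i j hij u).1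
    simp only [pairProduct, T] at h2
    have h3 : 0 < γ j u * β i j (up j u) ^ 2 := by
      have : γ j u * β i j (up j u) ^ 2 = (β i j (up j u) * β j i (up i u)) * γ i u := by
        linear_combination - β i j (up j u) * h1
      rw [this]; exact mul_pos h2 h
    exact pos_of_mul_pos_left h3 (sq_nonneg _)
  have other : ∀ i : Fin n, ∃ k, k ≠ i := fun i => by
    have : Nontrivial (Fin n) := Fin.nontrivial_iff_two_le.2 (by omega)
    exact exists_ne i
  obtain ⟨o, ho⟩ := h0
  refine sign o i u (lattice_induction (P := fun u => 0 < γ o u) (by simp [ho]) ?_ u)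
  intro k u
  obtain ⟨l, hl⟩ := other k
  have h1 := hγ.shift l k hl u
  have h2 := sub_pos.2 (hp l k hl u).2
  have : 0 < γ l u ↔ 0 < γ l (up k u) := by rw [h1]; exact (mul_pos_iff_of_pos_right h2).symm
  exact ⟨fun h => sign l o _ (this.1 (sign o l _ h)), fun h => sign l o _ (this.2 (sign o l _ h))⟩

end Metric

/-! ### The linear system and its compatibility. -/

section Wave

variable {𝕜 : Type*} [Field 𝕜] {n : ℕ} {β : Fin n → Fin n → (Fin n → ℤ) → 𝕜}

theorem v_eq (i : Fin n) (u : Fin n → ℤ) :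
    v β i u = -∑ p ∈ univ.erase i, β i p u * β p i (up i u) := by
  rw [v, Finset.filter_ne']; rfl

theorem v_eq_of_ne {i j : Fin n} (hij : i ≠ j) (u : Fin n → ℤ) :
    v β i u = -(β i j u * β j i (up i u))
      - ∑ p ∈ (univ.erase i).erase j, β i p u * β p i (up i u) := by
  rw [v_eq, ← Finset.add_sum_erase _ _ (Finset.mem_erase.2 ⟨hij.symm, mem_univ j⟩)]
  ring

/-- The transition matrix of the linear system
`T_j Z_i = Z_i + (T_j β_ij) Z_j`, `T_i Z_i = (ζ + v_i) Z_i - ∑_{j ≠ i} β_ij Z_j`. -/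
def waveMatrix (β : Fin n → Fin n → (Fin n → ℤ) → 𝕜) (ζ : 𝕜) (i : Fin n) (u : Fin n → ℤ) :
    Matrix (Fin n) (Fin n) 𝕜 :=
  Matrix.of fun a b =>
    if a = i then (if b = i then ζ + v β i u else -β i b u)
    else (if a = b then 1 else 0) + (if b = i then β a i (up i u) else 0)

variable {ζ : 𝕜} {i j : Fin n} {u : Fin n → ℤ}

theorem waveMatrix_self_self : waveMatrix β ζ i u i i = ζ + v β i u := by simp [waveMatrix]

theorem waveMatrix_self {b : Fin n} (hb : b ≠ i) : waveMatrix β ζ i u i b = -β i b u := by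
  simp [waveMatrix, hb]

theorem waveMatrix_col {a : Fin n} (ha : a ≠ i) : waveMatrix β ζ i u a i = β a i (up i u) := by
  simp [waveMatrix, ha]

theorem waveMatrix_of_ne {a b : Fin n} (ha : a ≠ i) (hb : b ≠ i) :
    waveMatrix β ζ i u a b = if a = b then 1 else 0 := by
  simp [waveMatrix, ha, hb]

theorem waveMatrix_mul_of_ne {m : Type*} (M : Matrix (Fin n) m 𝕜) {a : Fin n} (ha : a ≠ i)
    (b : m) : (waveMatrix β ζ i u * M) a b = M a b + β a i (up i u) * M i b := by
  simp [Matrix.mul_apply, waveMatrix, ha, add_mul, Finset.sum_add_distrib]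

theorem waveMatrix_mul_self {m : Type*} (M : Matrix (Fin n) m 𝕜) (b : m) :
    (waveMatrix β ζ i u * M) i b
      = (ζ + v β i u) * M i b - ∑ k ∈ univ.erase i, β i k u * M k b := by
  rw [Matrix.mul_apply, ← Finset.add_sum_erase _ _ (mem_univ i), waveMatrix_self_self,
    sub_eq_add_neg, ← Finset.sum_neg_distrib]
  congr 1
  refine Finset.sum_congr rfl fun k hk => ?_
  rw [waveMatrix_self (Finset.mem_erase.1 hk).1]
  ring

/-- Row `i` of the compatibility condition contains all the Lamé equations: column `i` gives `eq₂`,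
column `j` gives `eq₃`, the other columns give `eq₁`. The parameter `ζ` cancels. -/
theorem waveMatrix_compat_row_left (hij : i ≠ j) (b : Fin n) :
    (waveMatrix β ζ j (up i u) * waveMatrix β ζ i u) i b =
      if b = i then ζ + v β i u + β i j (up j (up i u)) * β j i (up i u)
      else if b = j then -β i j u + β i j (up j (up i u)) else -β i b u := by
  rw [waveMatrix_mul_of_ne _ hij]
  split_ifs with h1 h2
  · subst h1
    rw [waveMatrix_self_self, waveMatrix_col hij.symm]
  · subst h2
    rw [waveMatrix_self h1, waveMatrix_of_ne h1 h1]
    simp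
  · rw [waveMatrix_self h1, waveMatrix_of_ne hij.symm h1]
    simp [Ne.symm h2]

theorem waveMatrix_compat_row_right (hij : i ≠ j) (b : Fin n) :
    (waveMatrix β ζ i (up j u) * waveMatrix β ζ j u) i b =
      if b = i then ζ + v β i (up j u) + β i j (up j u) * β j i u
      else if b = j then β i j (up j u) * (v β i (up j u) - v β j u)
        - ∑ k ∈ (univ.erase i).erase j, β i k (up j u) * β k j (up j u)
      else β i j (up j u) * β j b u - β i b (up j u) := by
  rw [waveMatrix_mul_self, ← Finset.add_sum_erase _ _ (Finset.mem_erase.2 ⟨hij.symm, mem_univ j⟩)]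
  split_ifs with h1 h2
  · subst h1
    rw [waveMatrix_of_ne hij hij, if_pos rfl, waveMatrix_self hij, Finset.sum_eq_zero]
    · ring
    · intro k hk
      simp only [Finset.mem_erase] at hk
      rw [waveMatrix_of_ne hk.1 hij, if_neg hk.2.1, mul_zero]
  · subst h2
    rw [waveMatrix_col hij, waveMatrix_self_self, Finset.sum_congr rfl (g := fun k =>
      β i k (up b u) * β k b (up b u))]
    · ring
    · intro k hk
      rw [waveMatrix_col (Finset.mem_erase.1 hk).1]
  · rw [waveMatrix_of_ne hij h2, if_neg (Ne.symm h1), waveMatrix_self h2,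
      Finset.sum_eq_single b]
    · rw [waveMatrix_of_ne h2 h2]; simp; ring
    · intro k hk hkb
      rw [waveMatrix_of_ne (Finset.mem_erase.1 hk).1 h2, if_neg hkb, mul_zero]
    · intro h; simp [h1, h2] at h

theorem filter_ne_and_ne (i j : Fin n) :
    univ.filter (fun k => k ≠ i ∧ k ≠ j) = (univ.erase i).erase j := by
  ext k; simp [and_comm]

/-- The linear system is compatible if the discrete Lamé equations hold. -/
theorem LameEquations.waveMatrix_compat (hL : LameEquations β) (ζ : 𝕜) (hij : i ≠ j)
    (u : Fin n → ℤ) :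
    waveMatrix β ζ j (up i u) * waveMatrix β ζ i u
      = waveMatrix β ζ i (up j u) * waveMatrix β ζ j u := by
  have row : ∀ i j : Fin n, i ≠ j → ∀ b, (waveMatrix β ζ j (up i u) * waveMatrix β ζ i u) i b
      = (waveMatrix β ζ i (up j u) * waveMatrix β ζ j u) i b := by
    intro i j hij b
    rw [waveMatrix_compat_row_left hij, waveMatrix_compat_row_right hij]
    split_ifs with h1 h2
    · have := hL.eq₂ i j hij u
      simp only [Δ, T] at this
      linear_combination -this
    · have := hL.eq₃ i j hij u
      rw [filter_ne_and_ne] at this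
      simp only [Δ, T] at this
      linear_combination this
    · linear_combination hL.shift (Ne.symm h1) h2 hij u
  ext a b
  by_cases hai : a = i
  · subst hai; exact row a j hij b
  by_cases haj : a = j
  · subst haj; exact (row a i hij.symm b).symm
  rw [waveMatrix_mul_of_ne _ haj, waveMatrix_mul_of_ne _ hai]
  by_cases hbi : b = i
  · subst hbi
    rw [waveMatrix_col hai, waveMatrix_col hij.symm, waveMatrix_of_ne haj hij,
      waveMatrix_of_ne hij hij, if_neg hai, if_pos rfl, up_comm b j]
    linear_combination - hL.shift hai hij haj (up b u)
  by_cases hbj : b = j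
  · subst hbj
    rw [waveMatrix_col haj, waveMatrix_col hij, waveMatrix_of_ne hai hij.symm,
      waveMatrix_of_ne hij.symm hij.symm, if_neg haj, if_pos rfl, up_comm b i]
    linear_combination hL.shift haj hij.symm hai (up b u)
  rw [waveMatrix_of_ne hai hbi, waveMatrix_of_ne haj hbj, waveMatrix_of_ne hij hbj,
    waveMatrix_of_ne hij.symm hbi, if_neg (Ne.symm hbi), if_neg (Ne.symm hbj)]
  ring

/-- The discrete Lamé equations hold if the linear system is compatible. -/
theorem LameEquations.of_waveMatrix_compat
    (h : ∀ i j, i ≠ j → ∀ u, waveMatrix β ζ j (up i u) * waveMatrix β ζ i u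
      = waveMatrix β ζ i (up j u) * waveMatrix β ζ j u) : LameEquations β := by
  have row : ∀ i j, i ≠ j → ∀ u b, _ := fun i j hij u b =>
    (waveMatrix_compat_row_left hij b).symm.trans
      ((congrFun (congrFun (h i j hij u) i) b).trans (waveMatrix_compat_row_right hij b))
  refine ⟨fun i j k hij hjk hik u => ?_, fun i j hij u => ?_, fun i j hij u => ?_⟩
  · have := row i k hik u j
    simp only [if_neg hij.symm, if_neg hjk] at this
    simp only [Δ, T]
    linear_combination this
  · have := row i j hij u i
    simp only [if_true] at this
    simp only [Δ, T]
    linear_combination -this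
  · have := row i j hij u j
    simp only [if_neg hij.symm, if_true] at this
    rw [filter_ne_and_ne]
    simp only [Δ, T]
    linear_combination this

end Wave

/-! ### Transport of the Gram matrix and the spectral constant. -/

section Gram

variable {𝕜 : Type*} [Field 𝕜] {n : ℕ} {β : Fin n → Fin n → (Fin n → ℤ) → 𝕜}
  {γ : Fin n → (Fin n → ℤ) → 𝕜}

/-- The Gram matrix of the vectors spanning the edges at a vertex. -/
def gram (β : Fin n → Fin n → (Fin n → ℤ) → 𝕜) (γ : Fin n → (Fin n → ℤ) → 𝕜)
    (u : Fin n → ℤ) : Matrix (Fin n) (Fin n) 𝕜 :=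
  Matrix.of fun a b => if a = b then γ a u else -(β a b (up b u) * γ b u)

theorem gram_self (a : Fin n) (u : Fin n → ℤ) : gram β γ u a a = γ a u := by simp [gram]

theorem gram_of_ne {a b : Fin n} (h : a ≠ b) (u : Fin n → ℤ) :
    gram β γ u a b = -(β a b (up b u) * γ b u) := by simp [gram, h]

theorem IsMetric.gram_symm (hγ : IsMetric β γ) (a b : Fin n) (u : Fin n → ℤ) :
    gram β γ u a b = gram β γ u b a := by
  by_cases h : a = b
  · rw [h]
  · rw [gram_of_ne h, gram_of_ne (Ne.symm h), hγ.symm a b h]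

theorem IsMetric.gram_transpose (hγ : IsMetric β γ) (u : Fin n → ℤ) :
    (gram β γ u).transpose = gram β γ u := by
  ext a b; exact hγ.gram_symm b a u

/-- The lattice step in direction `j` projects the remaining edges orthogonally to edge `j`. -/
theorem IsMetric.gram_up_of_ne (hγ : IsMetric β γ) (hL : LameEquations β) {j a b : Fin n}
    (ha : a ≠ j) (hb : b ≠ j) (u : Fin n → ℤ) :
    gram β γ (up j u) a b = gram β γ u a b + β a j (up j u) * gram β γ u j b := by
  by_cases hab : a = b
  · subst hab
    rw [gram_self, gram_self, gram_of_ne (Ne.symm ha), hγ.shift a j ha]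
    simp only [pairProduct, T]
    ring
  · rw [gram_of_ne hab, gram_of_ne hab, gram_of_ne (Ne.symm hb), hγ.shift b j hb]
    linear_combination (-γ b u) * hL.shift_shift hab hb ha u

variable {ζ : 𝕜} {i j : Fin n} {u : Fin n → ℤ}

/-- Entries of `waveMatrix * gram` are the products of the shifted vectors with the old ones, so
this encodes `⟨T_i Z_a, Z_i⟩ = 0`, the orthogonality of the lattice. -/
theorem waveMatrix_mul_gram_col {a : Fin n} (ha : a ≠ i) :
    (waveMatrix β ζ i u * gram β γ u) a i = 0 := by
  rw [waveMatrix_mul_of_ne _ ha, gram_of_ne ha, gram_self]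
  ring

theorem waveMatrix_mul_gram_self :
    (waveMatrix β ζ i u * gram β γ u) i i = ζ * γ i u := by
  rw [waveMatrix_mul_self, gram_self, v_eq, add_mul, neg_mul, Finset.sum_mul, sub_eq_add_neg,
    ← Finset.sum_neg_distrib, ← Finset.sum_neg_distrib, add_assoc, ← Finset.sum_add_distrib,
    Finset.sum_eq_zero, add_zero]
  intro k hk
  rw [gram_of_ne (Finset.mem_erase.1 hk).1]
  ring

/-- Here `eq₂` and `eq₃` enter the transport of the metric: `eq₃` evaluates `T_i T_b β_ib`, and
`eq₂` removes the shift from `v_i`. -/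
theorem IsMetric.gram_up_self_of_ne (hγ : IsMetric β γ) (hL : LameEquations β) (ζ : 𝕜)
    {b : Fin n} (hb : b ≠ i) : gram β γ (up i u) i b
      = (waveMatrix β ζ i u * gram β γ u) i b + β b i (up i u) * (ζ * γ i u) := by
  have hib := hb.symm
  rw [waveMatrix_mul_self, ← Finset.add_sum_erase _ _ (Finset.mem_erase.2 ⟨hb, mem_univ b⟩),
    gram_self, gram_of_ne hib, gram_of_ne hib, hγ.shift b i hb]
  have h3 := hL.eq₃ i b hib u
  have h2 := hL.eq₂ i b hib u
  rw [filter_ne_and_ne] at h3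
  have hs := hγ.symm i b hib u
  simp only [Δ, T, pairProduct] at *
  have hv := v_eq_of_ne (β := β) hb u
  rw [Finset.erase_right_comm] at hv
  have s1 : ∑ k ∈ (univ.erase i).erase b, β i k u * gram β γ u k b
      = -(∑ k ∈ (univ.erase i).erase b, β i k u * β k b (up b u)) * γ b u := by
    rw [neg_mul, Finset.sum_mul, ← Finset.sum_neg_distrib]
    refine Finset.sum_congr rfl fun k hk => ?_
    rw [gram_of_ne (Finset.mem_erase.1 hk).1]
    ring
  have s2 : ∑ k ∈ (univ.erase i).erase b, β i k (up b u) * β k b (up b u)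
      = (∑ k ∈ (univ.erase i).erase b, β i k u * β k b (up b u))
        + β i b (up b u) * ∑ k ∈ (univ.erase i).erase b, β b k u * β k b (up b u) := by
    rw [Finset.mul_sum, ← Finset.sum_add_distrib]
    refine Finset.sum_congr rfl fun k hk => ?_
    simp only [Finset.mem_erase] at hk
    rw [hL.shift (Ne.symm hk.2.1) hk.1 hib u]
    ring
  rw [s1]
  rw [s2] at h3
  rw [up_comm b i] at *
  linear_combination (-γ b u) * h3 - γ b u * β i b (up b u) * h2 + γ b u * β i b (up b u) * hv
    - ζ * hs

/-- The spectral parameter of a Darboux-Egoroff lattice is a square root of this function, which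
turns out to be constant. -/
def spectral (β : Fin n → Fin n → (Fin n → ℤ) → 𝕜) (γ : Fin n → (Fin n → ℤ) → 𝕜)
    (i : Fin n) (u : Fin n → ℤ) : 𝕜 :=
  (γ i (up i u) - (waveMatrix β 0 i u * gram β γ u * (waveMatrix β 0 i u).transpose) i i) / γ i u

theorem mul_waveMatrix_transpose_of_ne {m : Type*} (M : Matrix m (Fin n) 𝕜) (a : m) {b : Fin n}
    (hb : b ≠ i) :
    (M * (waveMatrix β ζ i u).transpose) a b = M a b + β b i (up i u) * M a i := by
  have := waveMatrix_mul_of_ne (ζ := ζ) (β := β) (u := u) M.transpose hb a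
  rw [← Matrix.transpose_transpose M, ← Matrix.transpose_mul]
  simpa using this

theorem mul_waveMatrix_transpose_self {m : Type*} (M : Matrix m (Fin n) 𝕜) (a : m) :
    (M * (waveMatrix β ζ i u).transpose) a i
      = (ζ + v β i u) * M a i - ∑ k ∈ univ.erase i, β i k u * M a k := by
  have := waveMatrix_mul_self (ζ := ζ) (β := β) (u := u) M.transpose (i := i) a
  rw [← Matrix.transpose_transpose M, ← Matrix.transpose_mul]
  simpa using this

/-- The terms linear in `ζ` cancel by the choice of `v_i`, so the parameter enters the critical
entry only through `ζ²`. -/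
theorem IsMetric.waveMatrix_conj_self (hγ : IsMetric β γ) (ζ : 𝕜) :
    (waveMatrix β ζ i u * gram β γ u * (waveMatrix β ζ i u).transpose) i i
      = ζ ^ 2 * γ i u
        + (waveMatrix β 0 i u * gram β γ u * (waveMatrix β 0 i u).transpose) i i := by
  rw [mul_waveMatrix_transpose_self, mul_waveMatrix_transpose_self, waveMatrix_mul_gram_self,
    waveMatrix_mul_gram_self]
  have e : ∀ k, (waveMatrix β ζ i u * gram β γ u) i k
      = ζ * gram β γ u i k + (waveMatrix β 0 i u * gram β γ u) i k := by
    intro k; rw [waveMatrix_mul_self, waveMatrix_mul_self]; ring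
  have s : ∑ k ∈ univ.erase i, β i k u * gram β γ u i k = v β i u * γ i u := by
    rw [v_eq, neg_mul, Finset.sum_mul, ← Finset.sum_neg_distrib]
    refine Finset.sum_congr rfl fun k hk => ?_
    rw [hγ.gram_symm, gram_of_ne (Finset.mem_erase.1 hk).1]
    ring
  simp only [e, mul_add, Finset.sum_add_distrib, mul_left_comm _ ζ, ← Finset.mul_sum, s]
  ring

/-- The linear system transports the Gram matrix correctly up to a single diagonal entry, which is
correct exactly when `ζ²` equals `spectral`. -/
theorem IsMetric.gram_up (hγ : IsMetric β γ) (hL : LameEquations β) (ζ : 𝕜) (i : Fin n)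
    (u : Fin n → ℤ) : gram β γ (up i u)
      = waveMatrix β ζ i u * gram β γ u * (waveMatrix β ζ i u).transpose
        + Matrix.single i i ((spectral β γ i u - ζ ^ 2) * γ i u) := by
  have row : ∀ b, b ≠ i → gram β γ (up i u) i b
      = (waveMatrix β ζ i u * gram β γ u * (waveMatrix β ζ i u).transpose) i b := by
    intro b hb
    rw [mul_waveMatrix_transpose_of_ne _ _ hb, waveMatrix_mul_gram_self,
      hγ.gram_up_self_of_ne hL ζ hb]
  ext a b
  rw [Matrix.add_apply, Matrix.single_apply]
  by_cases ha : a = i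
  · subst ha
    by_cases hb : b = a
    · subst hb
      rw [if_pos ⟨rfl, rfl⟩, gram_self, hγ.waveMatrix_conj_self, spectral, sub_mul,
        div_mul_cancel₀ _ (hγ.ne_zero b u)]
      ring
    · rw [if_neg (fun h => hb h.2.symm), add_zero, row b hb]
  · rw [if_neg (fun h => ha h.1.symm), add_zero]
    by_cases hb : b = i
    · subst hb
      rw [hγ.gram_symm, row a ha]
      have : (waveMatrix β ζ b u * gram β γ u * (waveMatrix β ζ b u).transpose).transpose
          = waveMatrix β ζ b u * gram β γ u * (waveMatrix β ζ b u).transpose := by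
        simp [Matrix.transpose_mul, hγ.gram_transpose, Matrix.mul_assoc]
      exact congrFun (congrFun this a) b
    · rw [mul_waveMatrix_transpose_of_ne _ _ hb, waveMatrix_mul_gram_col ha,
        waveMatrix_mul_of_ne _ ha, hγ.gram_up_of_ne hL ha hb]
      ring

theorem mul_single_mul_transpose (M : Matrix (Fin n) (Fin n) 𝕜) (j : Fin n) (c : 𝕜)
    (a b : Fin n) : (M * Matrix.single j j c * M.transpose) a b = M a j * c * M b j := by
  rw [Matrix.mul_apply, Finset.sum_eq_single j]
  · simp
  · intro k _ hk
    rw [Matrix.mul_single_apply_of_ne]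
    · simp
    · exact hk
  · simp

/-- Computing the Gram matrix at `u + e_i + e_j` along both paths, the main parts agree by
compatibility and the rank-one errors must match. Entry `(i, j)` gives equality of the two indices,
entry `(j, j)` gives invariance under the step. -/
theorem IsMetric.spectral_const (hγ : IsMetric β γ) (hL : LameEquations β)
    (hβ : ∀ i j, i ≠ j → ∀ u, β i j u ≠ 0) (hij : i ≠ j) (u : Fin n → ℤ) :
    spectral β γ i u = spectral β γ j u ∧ spectral β γ j (up i u) = spectral β γ j u := by
  have h1 := hγ.gram_up hL 0 i (up j u)
  have h2 := hγ.gram_up hL 0 j (up i u)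
  rw [hγ.gram_up hL 0 j u] at h1
  rw [hγ.gram_up hL 0 i u, up_comm j i, h1] at h2
  have h3 := hL.waveMatrix_compat 0 hij u
  simp only [Matrix.mul_add, Matrix.add_mul, ← Matrix.mul_assoc] at h2
  simp only [Matrix.mul_assoc _ _ (Matrix.transpose _), ← Matrix.transpose_mul, h3] at h2
  simp only [← Matrix.mul_assoc] at h2
  have key : ∀ a b, _ := fun a b => congrFun (congrFun h2 a) b
  simp only [Matrix.add_apply, add_assoc, add_right_inj, mul_single_mul_transpose] at key
  have k1 := key i j
  have k2 := key j j
  rw [waveMatrix_self hij.symm, waveMatrix_of_ne hij.symm hij.symm,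
    waveMatrix_self hij, waveMatrix_of_ne hij hij] at k1
  rw [waveMatrix_self hij, waveMatrix_of_ne hij.symm hij.symm] at k2
  simp only [Matrix.single_apply, hij, hij.symm, if_true, and_self, and_true, and_false,
    if_false] at k1 k2
  have hs := hγ.symm i j hij u
  have hsh := hγ.shift j i hij.symm u
  have e1 : spectral β γ i u = spectral β γ j u := by
    refine mul_left_cancel₀ (mul_ne_zero (hβ i j hij (up j u)) (hγ.ne_zero j u)) ?_
    linear_combination k1 - spectral β γ i u * hs
  refine ⟨e1, ?_⟩
  refine mul_left_cancel₀ (hγ.ne_zero j (up i u)) ?_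
  rw [e1] at k2
  simp only [pairProduct, T] at hsh
  linear_combination -k2 - spectral β γ j u * β j i (up i u) * hs - spectral β γ j u * hsh

theorem IsMetric.spectral_eq (hγ : IsMetric β γ) (hn : 3 ≤ n) (hL : LameEquations β)
    (hβ : ∀ i j, i ≠ j → ∀ u, β i j u ≠ 0) (i j : Fin n) (u : Fin n → ℤ) :
    spectral β γ i u = spectral β γ j 0 := by
  have e : ∀ (i j : Fin n) (u : Fin n → ℤ), spectral β γ i u = spectral β γ j u := by
    intro i j u
    by_cases hij : i = j
    · rw [hij]
    · exact (hγ.spectral_const hL hβ hij u).1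
  have : Nontrivial (Fin n) := Fin.nontrivial_iff_two_le.2 (by omega)
  rw [e i j u]
  refine lattice_induction (P := fun u => spectral β γ j u = spectral β γ j 0) rfl ?_ u
  intro k u
  -- Invariance in direction `k` is known only for indices other than `k`.
  obtain ⟨l, hl⟩ := exists_ne k
  rw [e j l (up k u), (hγ.spectral_const hL hβ hl.symm u).2, e l j u]

end Gram

/-! ### Factorization and nondegeneracy of the Gram matrix. -/

section Factorization

variable {𝕜 : Type*} [Field 𝕜] {n : ℕ} {β : Fin n → Fin n → (Fin n → ℤ) → 𝕜}
  {γ : Fin n → (Fin n → ℤ) → 𝕜}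

/-- Away from index `j`, the Gram matrix at `u + e_j` is the Schur complement of the entry `(j, j)`
at `u`. Elimination of one index is thus a lattice step, and the pivots never vanish. -/
theorem IsMetric.gram_schur (hγ : IsMetric β γ) (hL : LameEquations β) {j a b : Fin n}
    (ha : a ≠ j) (hb : b ≠ j) (u : Fin n → ℤ) :
    gram β γ (up j u) a b * γ j u + gram β γ u a j * gram β γ u j b
      = gram β γ u a b * γ j u := by
  rw [hγ.gram_up_of_ne hL ha hb, gram_of_ne ha]
  ring

/-- The Gram matrix factorizes as `M Mᵀ` if its diagonal entries at all vertices are squares. -/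
theorem IsMetric.exists_factorization (hγ : IsMetric β γ) (hL : LameEquations β)
    (hsq : ∀ i u, IsSquare (γ i u)) (u : Fin n → ℤ) :
    ∃ M : Matrix (Fin n) (Fin n) 𝕜, M * M.transpose = gram β γ u := by
  suffices key : ∀ (s : Finset (Fin n)) (u : Fin n → ℤ), ∃ M : Fin n → Fin n → 𝕜,
      ∀ a ∈ s, ∀ b ∈ s, ∑ k ∈ s, M a k * M b k = gram β γ u a b by
    obtain ⟨M, hM⟩ := key univ u
    exact ⟨Matrix.of M, by
      ext a b
      simpa [Matrix.mul_apply] using hM a (mem_univ a) b (mem_univ b)⟩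
  intro s
  induction s using Finset.induction_on with
  | empty => exact fun u => ⟨0, by simp⟩
  | insert j s hj ih =>
    intro u
    obtain ⟨M, hM⟩ := ih (up j u)
    obtain ⟨r, hr⟩ := hsq j u
    have hne := hγ.ne_zero j u
    have hr0 : r ≠ 0 := by rintro rfl; simp [hr] at hne
    -- One step of Cholesky's method: column `j` is the pivot column divided by a root of the pivot,
    -- and row `j` vanishes elsewhere.
    refine ⟨fun a k => if k = j then gram β γ u a j / r else if a = j then 0 else M a k, ?_⟩
    have hs : ∀ k ∈ s, k ≠ j := fun k hk h => hj (h ▸ hk)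
    have head : ∀ a b, gram β γ u a j / r * (gram β γ u b j / r)
        = gram β γ u a j * gram β γ u j b / γ j u := by
      intro a b
      rw [hγ.gram_symm b j, hr]
      field_simp
    intro a ha b hb
    rw [Finset.sum_insert hj]
    simp only [if_true, head]
    by_cases haj : a = j
    · subst haj
      rw [Finset.sum_eq_zero, gram_self, add_zero, mul_div_cancel_left₀ _ hne]
      intro k hk; simp [hs k hk]
    by_cases hbj : b = j
    · subst hbj
      rw [Finset.sum_eq_zero, gram_self, add_zero, mul_div_cancel_right₀ _ hne]
      intro k hk; simp [hs k hk]
    have ha' := (Finset.mem_insert.1 ha).resolve_left haj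
    have hb' := (Finset.mem_insert.1 hb).resolve_left hbj
    rw [Finset.sum_congr rfl (g := fun k => M a k * M b k)
      (fun k hk => by simp [hs k hk, haj, hbj]), hM a ha' b hb']
    have := hγ.gram_schur hL haj hbj u
    field_simp
    linear_combination this

/-- Gaussian elimination with the nonzero pivots `γ_j`, each elimination moving to the vertex `u +
e_j`. -/
theorem IsMetric.gram_nondegenerate (hγ : IsMetric β γ) (hL : LameEquations β)
    (u : Fin n → ℤ) (c : Fin n → 𝕜) (hc : Matrix.mulVec (gram β γ u) c = 0) : c = 0 := by
  suffices key : ∀ (s : Finset (Fin n)) (u : Fin n → ℤ),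
      (∀ a ∈ s, ∑ b ∈ s, gram β γ u a b * c b = 0) → ∀ a ∈ s, c a = 0 by
    ext a
    exact key univ u (fun a _ => congrFun hc a) a (mem_univ a)
  intro s
  induction s using Finset.induction_on with
  | empty => simp
  | insert j s hj ih =>
    intro u h
    have hs : ∀ k ∈ s, k ≠ j := fun k hk h => hj (h ▸ hk)
    have h0 := h j (mem_insert_self j s)
    rw [Finset.sum_insert hj, gram_self] at h0
    have hne := hγ.ne_zero j u
    have hz := ih (up j u) (fun a ha => by
      have h1 := h a (mem_insert_of_mem ha)
      rw [Finset.sum_insert hj] at h1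
      have e : (∑ b ∈ s, gram β γ (up j u) a b * c b) * γ j u
          = (∑ b ∈ s, gram β γ u a b * c b) * γ j u
            - gram β γ u a j * ∑ b ∈ s, gram β γ u j b * c b := by
        rw [Finset.sum_mul, Finset.sum_mul, Finset.mul_sum, ← Finset.sum_sub_distrib]
        refine Finset.sum_congr rfl fun b hb => ?_
        linear_combination c b * hγ.gram_schur hL (hs a ha) (hs b hb) u
      refine (mul_eq_zero.1 (e.trans ?_)).resolve_right hne
      linear_combination γ j u * h1 - gram β γ u a j * h0)
    intro a ha
    rcases Finset.mem_insert.1 ha with rfl | ha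
    · rw [Finset.sum_eq_zero (fun b hb => by rw [hz b hb, mul_zero]), add_zero] at h0
      exact (mul_eq_zero.1 h0).resolve_left hne
    · exact hz a ha

/-- A vector in the left kernel of `waveMatrix β 0 i u`. -/
def waveKernel (β : Fin n → Fin n → (Fin n → ℤ) → 𝕜) (i : Fin n) (u : Fin n → ℤ) : Fin n → 𝕜 :=
  fun a => if a = i then 1 else β i a u

theorem waveKernel_self (i : Fin n) (u : Fin n → ℤ) : waveKernel β i u i = 1 := if_pos rfl

theorem waveKernel_of_ne {a i : Fin n} (h : a ≠ i) (u : Fin n → ℤ) :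
    waveKernel β i u a = β i a u := if_neg h

theorem waveKernel_vecMul (i : Fin n) (u : Fin n → ℤ) :
    Matrix.vecMul (waveKernel β i u) (waveMatrix β 0 i u) = 0 := by
  ext b
  rw [Matrix.vecMul, dotProduct, ← Finset.add_sum_erase _ _ (mem_univ i), waveKernel_self,
    one_mul]
  by_cases hb : b = i
  · subst hb
    have : ∑ p ∈ univ.erase b, waveKernel β b u p * waveMatrix β 0 b u p b
        = ∑ p ∈ univ.erase b, β b p u * β p b (up b u) := by
      refine Finset.sum_congr rfl fun k hk => ?_
      have hk := (Finset.mem_erase.1 hk).1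
      rw [waveKernel_of_ne hk, waveMatrix_col hk]
    rw [this, waveMatrix_self_self, v_eq, zero_add, neg_add_cancel, Pi.zero_apply]
  · rw [waveMatrix_self hb, Finset.sum_eq_single b, waveKernel_of_ne hb, waveMatrix_of_ne hb hb,
      if_pos rfl]
    · simp
    · intro k hk hkb
      rw [waveMatrix_of_ne (Finset.mem_erase.1 hk).1 hb, if_neg hkb, mul_zero]
    · intro h; simp [hb] at h

/-- At `ζ = 0` the kernel vector annihilates the transported part of the Gram matrix, so only the
diagonal error survives. -/
theorem IsMetric.waveKernel_vecMul_gram (hγ : IsMetric β γ) (hL : LameEquations β) (i : Fin n)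
    (u : Fin n → ℤ) : Matrix.vecMul (waveKernel β i u) (gram β γ (up i u))
      = Pi.single i (spectral β γ i u * γ i u) := by
  rw [hγ.gram_up hL 0, Matrix.vecMul_add, Matrix.mul_assoc, ← Matrix.vecMul_vecMul,
    waveKernel_vecMul, Matrix.zero_vecMul, zero_add]
  ext b
  rw [Matrix.vecMul, dotProduct, Finset.sum_eq_single i]
  · simp [waveKernel, Matrix.single_apply, Pi.single_apply, eq_comm]
  · intro k _ hk; simp [hk.symm]
  · simp

theorem IsMetric.spectral_ne_zero (hγ : IsMetric β γ) (hL : LameEquations β) (i : Fin n)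
    (u : Fin n → ℤ) : spectral β γ i u ≠ 0 := by
  intro h
  have h1 := hγ.waveKernel_vecMul_gram hL i u
  rw [h, zero_mul, Pi.single_zero, ← hγ.gram_transpose, Matrix.vecMul_transpose] at h1
  have := congrFun (hγ.gram_nondegenerate hL _ _ h1) i
  simp [waveKernel] at this

/-- The value of the Gram form on the kernel vector is `spectral` times `γ_i`, and a real form `M
Mᵀ` is nonnegative. -/
theorem IsMetric.spectral_pos {β : Fin n → Fin n → (Fin n → ℤ) → ℝ}
    {γ : Fin n → (Fin n → ℤ) → ℝ} (hγ : IsMetric β γ) (hL : LameEquations β)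
    (hpos : ∀ i u, 0 < γ i u) (i : Fin n) (u : Fin n → ℤ) : 0 < spectral β γ i u := by
  obtain ⟨M, hM⟩ := hγ.exists_factorization hL
    (fun i u => ⟨√(γ i u), (Real.mul_self_sqrt (hpos i u).le).symm⟩) (up i u)
  have h1 := hγ.waveKernel_vecMul_gram hL i u
  have h2 : 0 ≤ spectral β γ i u * γ i u := by
    have : spectral β γ i u * γ i u
        = Matrix.vecMul (waveKernel β i u) (gram β γ (up i u)) ⬝ᵥ waveKernel β i u := by
      rw [h1]; simp [waveKernel]
    rw [this, ← hM, ← Matrix.vecMul_vecMul, Matrix.vecMul_transpose, dotProduct_comm,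
      Matrix.dotProduct_mulVec]
    exact Finset.sum_nonneg fun k _ => mul_self_nonneg _
  exact lt_of_le_of_ne (nonneg_of_mul_nonneg_left h2 (hpos i u))
    (hγ.spectral_ne_zero hL i u).symm

theorem IsMetric.isUnit_of_factorization (hγ : IsMetric β γ) (hL : LameEquations β)
    {u : Fin n → ℤ} {M : Matrix (Fin n) (Fin n) 𝕜} (hM : M * M.transpose = gram β γ u) :
    IsUnit M := by
  rw [← Matrix.isUnit_transpose, ← Matrix.mulVec_injective_iff_isUnit]
  refine (injective_iff_map_eq_zero (Matrix.mulVecLin M.transpose)).2 fun c hc => ?_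
  refine hγ.gram_nondegenerate hL u c ?_
  rw [← hM, ← Matrix.mulVec_mulVec]
  rw [Matrix.mulVecLin_apply] at hc
  rw [hc, Matrix.mulVec_zero]

end Factorization

/-! ### Nowhere vanishing solutions of the linear system for Lamé coefficients. -/

section Goursat

variable {𝕜 : Type*} [Field 𝕜] {n : ℕ} {β : Fin n → Fin n → (Fin n → ℤ) → 𝕜}
  {γ : Fin n → (Fin n → ℤ) → 𝕜}

/-- The linear system `Δ_i h_k = β_ik T_i h_i` for discrete Lamé coefficients. -/
def IsLameSolution (β : Fin n → Fin n → (Fin n → ℤ) → 𝕜) (h : Fin n → (Fin n → ℤ) → 𝕜) : Prop :=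
  ∀ i k, i ≠ k → ∀ u, h k (up i u) = h k u + β i k u * h i (up i u)

/-- The same system inside the hyperplane `u_j = m`. -/
def IsSlabSolution (β : Fin n → Fin n → (Fin n → ℤ) → 𝕜) (j : Fin n) (m : ℤ)
    (h : Fin n → (Fin n → ℤ) → 𝕜) : Prop :=
  ∀ i k, i ≠ j → i ≠ k → ∀ u : Fin n → ℤ, u j = m →
    h k (up i u) = h k u + β i k u * h i (up i u)

theorem isSlabSolution_zero (j : Fin n) (m : ℤ) : IsSlabSolution β j m 0 := by
  intro i k _ _ u _; simp

/-- On the next hyperplane only `h_j` is unknown. Its equations in the directions `i ≠ j` involve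
the factor `1 - p_ij`, and `γ_j` is an integrating factor: `γ_j T_j h_j` is a potential of a known
one-form. -/
theorem exists_slab_up_of_potential (hL : LameEquations β) (hγ : IsMetric β γ) {j : Fin n} {m : ℤ}
    {h : Fin n → (Fin n → ℤ) → 𝕜} (hh : IsSlabSolution β j m h) {w : (Fin n → ℤ) → 𝕜}
    (hw : ∀ i, i ≠ j → ∀ u : Fin n → ℤ, u j = m →
      w (up i u) = w u + β i j (up j u) * γ j u * h i (up i u)) :
    ∃ h', IsSlabSolution β j (m + 1) h' ∧ (∀ u, h' j (up j u) = w u / γ j u) ∧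
      ∀ k, k ≠ j → ∀ u, h' k (up j u) = h k u + β j k u * h' j (up j u) := by
  let h' : Fin n → (Fin n → ℤ) → 𝕜 := fun k u => if k = j then w (down j u) / γ j (down j u)
    else h k (down j u) + β j k (down j u) * (w (down j u) / γ j (down j u))
  have hj : ∀ u, h' j (up j u) = w u / γ j u := by intro u; simp [h']
  have hk : ∀ k, k ≠ j → ∀ u, h' k (up j u) = h k u + β j k u * h' j (up j u) := by
    intro k hk u; simp [h', hk]
  refine ⟨h', ?_, hj, hk⟩
  intro i k hij hik u hu
  obtain ⟨u, rfl⟩ : ∃ u', u = up j u' := ⟨down j u, by simp⟩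
  have hu : u j = m := by simpa using hu
  have hy : h' j (up j (up i u)) = h' j (up j u) + β i j (up j u) * h' i (up i (up j u)) := by
    rw [up_comm i j, hk i hij, hj, hj, hw i hij u hu, hγ.shift j i hij.symm]
    have n1 := hγ.ne_zero j u
    have n2 := hγ.ne_zero j (up i u)
    rw [hγ.shift j i hij.symm] at n2
    simp only [pairProduct, T] at *
    have n3 := right_ne_zero_of_mul n2
    have n4 : 1 - β i j (up j u) * β j i (up i u) ≠ 0 := by rwa [mul_comm (β i j _)]
    field_simp
    ring
  by_cases hkj : k = j
  · subst hkj
    rw [← hy, up_comm]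
  have h1 := hL.shift hik hkj hij u
  have h2 := hL.shift (Ne.symm hkj) (Ne.symm hik) hij.symm u
  have h3 := hh i k hij hik u hu
  rw [up_comm i j] at hy ⊢
  rw [hk i hij] at hy ⊢
  rw [hk k hkj, hk k hkj, h3]
  linear_combination β j k u * hy + h' j (up j (up i u)) * h2
    - (h i (up i u) + β j i (up i u) * h' j (up j (up i u))) * h1

theorem exists_slab_up (hL : LameEquations β) (hγ : IsMetric β γ) {j : Fin n} {m : ℤ}
    {h : Fin n → (Fin n → ℤ) → 𝕜} (hh : IsSlabSolution β j m h) :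
    ∃ h', IsSlabSolution β j (m + 1) h' ∧
      ∀ k, k ≠ j → ∀ u, h' k (up j u) = h k u + β j k u * h' j (up j u) := by
  obtain ⟨w, hw⟩ := exists_potential_slab j m
    (fun i u => β i j (up j u) * γ j u * h i (up i u)) (by
      intro i k hi hk hik u hu
      have h1 := hh i k hi hik (up k u) (by rwa [up_of_ne hk.symm])
      have h2 := hh k i hk hik.symm (up i u) (by rwa [up_of_ne hi.symm])
      have e1 := hL.shift_shift hk hi.symm hik.symm u
      have e2 := hL.shift_shift hi hk.symm hik u
      rw [hγ.shift j i hi.symm, hγ.shift j k hk.symm]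
      rw [up_comm k i] at *
      linear_combination γ j u * h k (up i (up k u)) * e1 - γ j u * h i (up i (up k u)) * e2
        - γ j u * β i j (up j u) * h2 + γ j u * β k j (up j u) * h1)
  obtain ⟨h', h1, -, h2⟩ := exists_slab_up_of_potential hL hγ hh hw
  exact ⟨h', h1, h2⟩

theorem IsSlabSolution.down (hL : LameEquations β) {j : Fin n} {m : ℤ}
    {h : Fin n → (Fin n → ℤ) → 𝕜} (hh : IsSlabSolution β j (m + 1) h) {i k : Fin n} (hij : i ≠ j)
    (hkj : k ≠ j) (hik : i ≠ k) {u : Fin n → ℤ} (hu : u j = m) :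
    h k (up j (up i u)) - β j k (up i u) * h j (up j (up i u))
      = h k (up j u) - β j k u * h j (up j u)
        + β i k u * (h i (up j (up i u)) - β j i (up i u) * h j (up j (up i u))) := by
  have hu' : up j u j = m + 1 := by simp [hu]
  have h1 := hL.shift hik hkj hij u
  have h2 := hL.shift hkj.symm hik.symm hij.symm u
  have h3 := hh i k hij hik (up j u) hu'
  have h4 := hh i j hij hij (up j u) hu'
  rw [up_comm i j] at h3 h4
  linear_combination h3 - β j k u * h4 - h j (up j (up i u)) * h2 + h i (up j (up i u)) * h1

/-- Downwards the components `k ≠ j` are determined by the equations in direction `j`, and `h_j`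
itself is a potential. -/
theorem exists_slab_down_of_potential (hL : LameEquations β) {j : Fin n} {m : ℤ}
    {h : Fin n → (Fin n → ℤ) → 𝕜} (hh : IsSlabSolution β j (m + 1) h) {w : (Fin n → ℤ) → 𝕜}
    (hw : ∀ i, i ≠ j → ∀ u : Fin n → ℤ, u j = m → w (up i u)
      = w u + β i j u * (h i (up j (up i u)) - β j i (up i u) * h j (up j (up i u)))) :
    ∃ h', IsSlabSolution β j m h' ∧ (∀ u, h' j u = w u) ∧
      ∀ k, k ≠ j → ∀ u, h k (up j u) = h' k u + β j k u * h j (up j u) := by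
  let h' : Fin n → (Fin n → ℤ) → 𝕜 := fun k u => if k = j then w u
    else h k (up j u) - β j k u * h j (up j u)
  have hj : ∀ u, h' j u = w u := by intro u; simp [h']
  have hk : ∀ k, k ≠ j → ∀ u, h' k u = h k (up j u) - β j k u * h j (up j u) := by
    intro k hk u; simp [h', hk]
  refine ⟨h', ?_, hj, fun k hkj u => by rw [hk k hkj]; ring⟩
  intro i k hij hik u hu
  by_cases hkj : k = j
  · subst hkj
    rw [hj, hj, hw i hij u hu, hk i hij]
  rw [hk k hkj, hk k hkj, hk i hij]
  exact hh.down hL hij hkj hik hu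

theorem exists_slab_down (hL : LameEquations β) {j : Fin n} {m : ℤ}
    {h : Fin n → (Fin n → ℤ) → 𝕜} (hh : IsSlabSolution β j (m + 1) h) :
    ∃ h', IsSlabSolution β j m h' ∧
      ∀ k, k ≠ j → ∀ u, h k (up j u) = h' k u + β j k u * h j (up j u) := by
  obtain ⟨w, hw⟩ := exists_potential_slab j m (fun i u =>
      β i j u * (h i (up j (up i u)) - β j i (up i u) * h j (up j (up i u)))) (by
      intro i k hi hk hik u hu
      have h1 := hh.down hL hi hk hik (u := up k u) (by rwa [up_of_ne hk.symm])
      have h2 := hh.down hL hk hi hik.symm (u := up i u) (by rwa [up_of_ne hi.symm])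
      have e1 := hL.shift hk hi.symm hik.symm u
      have e2 := hL.shift hi hk.symm hik u
      rw [up_comm k i] at *
      linear_combination
        (h k (up j (up i (up k u))) - β j k (up i (up k u)) * h j (up j (up i (up k u)))) * e1
        - (h i (up j (up i (up k u))) - β j i (up i (up k u)) * h j (up j (up i (up k u)))) * e2
        - β i j u * h2 + β k j u * h1)
  obtain ⟨h', h1, -, h2⟩ := exists_slab_down_of_potential hL hh hw
  exact ⟨h', h1, h2⟩

theorem exists_seq_of_step {α : Type*} (P : ℕ → α → Prop) (R : α → α → Prop) {x : α} (hx : P 0 x)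
    (hstep : ∀ p x, P p x → ∃ y, P (p + 1) y ∧ R x y) :
    ∃ s : ℕ → α, s 0 = x ∧ (∀ p, P p (s p)) ∧ ∀ p, R (s p) (s (p + 1)) := by
  choose next n1 n2 using hstep
  let s : ∀ p : ℕ, {x // P p x} := fun p => Nat.rec ⟨x, hx⟩ (fun p x => ⟨next p x x.2, n1 _ _ _⟩) p
  exact ⟨fun p => (s p).1, rfl, fun p => (s p).2, fun p => n2 p _ (s p).2⟩

/-- There is a solution supported in the half-space `m < u_j` whose `j`-th component does not
vanish on the bounding hyperplane. -/
theorem exists_solution_above (hL : LameEquations β) (hγ : IsMetric β γ) (j : Fin n) (m : ℤ) :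
    ∃ h, IsLameSolution β h ∧ (∀ k u, u j ≤ m → h k u = 0) ∧ ∀ u, u j = m + 1 → h j u ≠ 0 := by
  -- Above the zero solution the potential is an arbitrary constant; the value `1` makes `h_j = 1 /
  -- γ_j` on the first nonzero hyperplane.
  obtain ⟨h0, s0, hj0, hk0⟩ := exists_slab_up_of_potential hL hγ (isSlabSolution_zero j m)
    (w := fun _ => 1) (by simp)
  obtain ⟨s, hs0, hs, hstep⟩ := exists_seq_of_step
    (fun (p : ℕ) h => IsSlabSolution β j (m + 1 + p) h)
    (fun h h' => ∀ k, k ≠ j → ∀ u, h' k (up j u) = h k u + β j k u * h' j (up j u))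
    (x := h0) (by simpa using s0) (fun p h hh => by
      rw [Nat.cast_succ, ← add_assoc]; exact exists_slab_up hL hγ hh)
  refine ⟨fun k u => if m < u j then s (u j - m - 1).toNat k u else 0, ?_, ?_, ?_⟩
  · intro i k hik u
    dsimp only
    by_cases hi : i = j
    · subst hi
      rw [up_self]
      rcases lt_trichotomy (u i) m with hu | hu | hu
      · rw [if_neg (by omega), if_neg (by omega), if_neg (by omega)]
        simp
      · rw [if_pos (by omega), if_neg (by omega), if_pos (by omega),
          show (u i + 1 - m - 1).toNat = 0 by omega, hs0]
        simpa using hk0 k hik.symm u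
      · rw [if_pos (by omega), if_pos (by omega), if_pos (by omega),
          show (u i + 1 - m - 1).toNat = (u i - m - 1).toNat + 1 by omega]
        exact hstep _ k hik.symm u
    · rw [up_of_ne (Ne.symm hi)]
      split_ifs with hu
      · exact hs _ i k hi hik u (by omega)
      · simp
  · intro k u hu
    exact if_neg (by omega)
  · intro u hu
    dsimp only
    rw [if_pos (by omega), show (u j - m - 1).toNat = 0 by omega, hs0, ← up_down j u, hj0]
    exact div_ne_zero one_ne_zero (hγ.ne_zero _ _)

/-- There is a solution supported in the half-space `u_j ≤ m` which on the bounding hyperplane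
equals the `j`-th coordinate vector. -/
theorem exists_solution_below (hL : LameEquations β) (j : Fin n) (m : ℤ) :
    ∃ h, IsLameSolution β h ∧ (∀ k u, m < u j → h k u = 0) ∧ ∀ u, u j = m → h j u = 1 := by
  obtain ⟨h0, s0, hj0, hk0⟩ := exists_slab_down_of_potential hL (isSlabSolution_zero j (m + 1))
    (w := fun _ => 1) (by simp)
  obtain ⟨s, hs0, hs, hstep⟩ := exists_seq_of_step
    (fun (p : ℕ) h => IsSlabSolution β j (m - p) h)
    (fun h h' => ∀ k, k ≠ j → ∀ u, h k (up j u) = h' k u + β j k u * h j (up j u))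
    (x := h0) (by simpa using s0) (fun p h hh => exists_slab_down hL (by
      rwa [Nat.cast_succ, ← sub_sub, sub_add_cancel]))
  refine ⟨fun k u => if u j ≤ m then s (m - u j).toNat k u else 0, ?_, ?_, ?_⟩
  · intro i k hik u
    dsimp only
    by_cases hi : i = j
    · subst hi
      rw [up_self]
      rcases lt_trichotomy (u i) m with hu | hu | hu
      · rw [if_pos (by omega), if_pos (by omega), if_pos (by omega),
          show (m - u i).toNat = (m - (u i + 1)).toNat + 1 by omega]
        exact hstep _ k hik.symm u
      · rw [if_neg (by omega), if_pos (by omega), if_neg (by omega),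
          show (m - u i).toNat = 0 by omega, hs0]
        simpa using hk0 k hik.symm u
      · rw [if_neg (by omega), if_neg (by omega), if_neg (by omega)]
        simp
    · rw [up_of_ne (Ne.symm hi)]
      split_ifs with hu
      · exact hs _ i k hi hik u (by omega)
      · simp
  · intro k u hu
    exact if_neg (by omega)
  · intro u hu
    dsimp only
    rw [if_pos (by omega), show (m - u j).toNat = 0 by omega, hs0, hj0]

theorem isUnit_waveMatrix {ζ : 𝕜} (hζ : ζ ≠ 0) (i : Fin n) (u : Fin n → ℤ) :
    IsUnit (waveMatrix β ζ i u) := by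
  rw [← Matrix.mulVec_injective_iff_isUnit]
  refine (injective_iff_map_eq_zero (Matrix.mulVecLin (waveMatrix β ζ i u))).2 fun c hc => ?_
  have h1 : ∀ a, a ≠ i → c a + β a i (up i u) * c i = 0 := fun a ha =>
    (waveMatrix_mul_of_ne (Matrix.of fun a (_ : Unit) => c a) ha ()).symm.trans (congrFun hc a)
  have h2 : (ζ + v β i u) * c i - ∑ k ∈ univ.erase i, β i k u * c k = 0 :=
    (waveMatrix_mul_self (Matrix.of fun a (_ : Unit) => c a) ()).symm.trans (congrFun hc i)
  have h3 : ∑ k ∈ univ.erase i, β i k u * c k = v β i u * c i := by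
    rw [v_eq, neg_mul, Finset.sum_mul, ← Finset.sum_neg_distrib]
    refine Finset.sum_congr rfl fun k hk => ?_
    linear_combination β i k u * h1 k (Finset.mem_erase.1 hk).1
  -- Eliminating the other components leaves `ζ c_i = 0`.
  have h4 : c i = 0 := by
    refine (mul_eq_zero.1 ?_).resolve_left hζ
    linear_combination h2 + h3
  ext a
  by_cases ha : a = i
  · rw [ha, h4]; rfl
  · simpa [h4] using h1 a ha

/-- The linear system has a solution with arbitrary invertible initial value. -/
theorem exists_wave (hL : LameEquations β) {ζ : 𝕜} (hζ : ζ ≠ 0)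
    {M : Matrix (Fin n) (Fin n) 𝕜} (hM : IsUnit M) :
    ∃ Φ : (Fin n → ℤ) → Matrix (Fin n) (Fin n) 𝕜, Φ 0 = M ∧ (∀ u, IsUnit (Φ u)) ∧
      ∀ i u, Φ (up i u) = waveMatrix β ζ i u * Φ u := by
  obtain ⟨Φ, h0, hΦ⟩ := exists_path (fun i u => (isUnit_waveMatrix (β := β) hζ i u).unit)
    (fun i j hij u => by ext1; exact hL.waveMatrix_compat ζ hij u)
  refine ⟨fun u => Φ u * M, by simp [h0], fun u => (Φ u).isUnit.mul hM, fun i u => ?_⟩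
  simp [hΦ, Matrix.mul_assoc]

/-- There is a solution with arbitrary values at the origin. -/
theorem exists_solution (hL : LameEquations β) (a : Fin n → 𝕜) :
    ∃ h, IsLameSolution β h ∧ ∀ i, h i 0 = a i := by
  obtain ⟨Φ, h0, hu, hΦ⟩ := exists_wave hL (ζ := 1) one_ne_zero isUnit_one
  -- The system for `h` is dual to the one for `Z`: `h` solves it when the row vector `h Φ` is
  -- constant. Any nonzero parameter serves, here `1`.
  refine ⟨fun k u => Matrix.vecMul a (Φ u)⁻¹ k, fun i k hik u => ?_, fun i => by simp [h0]⟩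
  have key : Matrix.vecMul (Matrix.vecMul a (Φ (up i u))⁻¹) (waveMatrix β 1 i u)
      = Matrix.vecMul a (Φ u)⁻¹ := by
    have hA := isUnit_waveMatrix (β := β) one_ne_zero i u
    rw [hΦ, Matrix.mul_inv_rev, Matrix.vecMul_vecMul, Matrix.mul_assoc,
      Matrix.nonsing_inv_mul _ ((Matrix.isUnit_iff_isUnit_det _).1 hA), Matrix.mul_one]
  have := congrFun key k
  have e : ∀ y : Fin n → 𝕜, Matrix.vecMul y (waveMatrix β 1 i u) k = y k - β i k u * y i := by
    intro y
    rw [Matrix.vecMul, dotProduct, ← Finset.add_sum_erase _ _ (mem_univ i),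
      waveMatrix_self hik.symm, Finset.sum_eq_single k, waveMatrix_of_ne hik.symm hik.symm,
      if_pos rfl]
    · ring
    · intro b hb hbk
      rw [waveMatrix_of_ne (Finset.mem_erase.1 hb).1 hik.symm, if_neg hbk, mul_zero]
    · intro h; simp [hik.symm] at h
  rw [e] at this
  linear_combination this

theorem IsLameSolution.apply_corner (hL : LameEquations β) {h : Fin n → (Fin n → ℤ) → 𝕜}
    (hh : IsLameSolution β h) (S : Finset (Fin n)) {j : Fin n} (hj : j ∉ S) :
    h j (corner S) = h j 0 - ∑ k ∈ S, β k j (corner S) * h k 0 := by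
  induction S using Finset.induction_on generalizing j with
  | empty =>
    have : corner (∅ : Finset (Fin n)) = 0 := by ext; simp [corner]
    simp [this]
  | insert i S hi ih =>
    have e : up i (corner (insert i S)) = corner S := by
      ext k
      by_cases hk : k = i
      · subst hk; simp [corner, hi]
      · simp [corner, up_of_ne hk, hk]
    have hji : j ≠ i := fun h => hj (h ▸ mem_insert_self _ _)
    have hjS : j ∉ S := fun h => hj (mem_insert_of_mem h)
    have h1 := hh i j hji.symm (corner (insert i S))
    rw [e, ih hjS, ih hi] at h1
    rw [Finset.sum_insert hi]
    have h2 : ∑ k ∈ S, β k j (corner S) * h k 0 = ∑ k ∈ S, β k j (corner (insert i S)) * h k 0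
        + β i j (corner (insert i S)) * ∑ k ∈ S, β k i (corner S) * h k 0 := by
      rw [Finset.mul_sum, ← Finset.sum_add_distrib]
      refine Finset.sum_congr rfl fun k hk => ?_
      have h3 := hL.shift (i := k) (j := j) (k := i) (fun h => hjS (h ▸ hk)) hji
        (fun h => hi (h ▸ hk)) (corner (insert i S))
      rw [e] at h3
      linear_combination h k 0 * h3
    linear_combination -h1 - h2

/-- Countably many nonzero linear forms over an uncountable field do not vanish simultaneously
at a suitable point. -/
theorem exists_forall_linearCombination_ne_zero [Uncountable 𝕜] {ι : Type*} [Countable ι]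
    {C : Set (ι →₀ 𝕜)} (hC : C.Countable) (h0 : (0 : ι →₀ 𝕜) ∉ C) :
    ∃ t : ι → 𝕜, ∀ c ∈ C, Finsupp.linearCombination 𝕜 t c ≠ 0 := by
  obtain ⟨e, he⟩ := exists_injective_nat ι
  -- On the curve `t_s = τ^(e s)` each linear form is a nonzero polynomial in `τ`, with finitely
  -- many roots.
  let P : (ι →₀ 𝕜) → Polynomial 𝕜 := fun c => ∑ s ∈ c.support, Polynomial.monomial (e s) (c s)
  have hP : ∀ c ∈ C, P c ≠ 0 := by
    intro c hc hPc
    have hne : c ≠ 0 := fun h => h0 (h ▸ hc)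
    obtain ⟨s, hs⟩ := Finsupp.support_nonempty_iff.2 hne
    have h1 : (P c).coeff (e s) = c s := by
      simp only [P, Polynomial.finsetSum_coeff, Polynomial.coeff_monomial]
      rw [Finset.sum_eq_single s]
      · simp
      · intro k _ hk; rw [if_neg (fun h => hk (he h))]
      · intro h; exact absurd hs h
    rw [hPc, Polynomial.coeff_zero] at h1
    exact (Finsupp.mem_support_iff.1 hs) h1.symm
  have hbad : (⋃ c ∈ C, {τ | (P c).IsRoot τ}).Countable :=
    hC.biUnion fun c hc => (Polynomial.finite_setOfPred_isRoot (hP c hc)).countable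
  obtain ⟨τ, hτ⟩ : ∃ τ, τ ∉ ⋃ c ∈ C, {τ | (P c).IsRoot τ} := by
    by_contra! h
    exact Set.not_countable_univ (hbad.mono fun τ _ => h τ)
  refine ⟨fun s => τ ^ e s, fun c hc h => hτ ?_⟩
  simp only [Set.mem_iUnion, Set.mem_ofPred_eq]
  refine ⟨c, hc, ?_⟩
  rw [Polynomial.IsRoot, Polynomial.eval_finsetSum]
  simpa [Finsupp.linearCombination_apply, Finsupp.sum] using h

/-- The half-spaces `u_j ≥ m > 0` and `u_j ≤ m < 0` avoid the origin, so these solutions can be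
added without changing initial values, and only finitely many are nonzero at any given point. -/
theorem exists_elementary_solution (hL : LameEquations β) (hγ : IsMetric β γ) (j : Fin n) (m : ℤ) :
    ∃ h, IsLameSolution β h ∧ (∀ k u, u j < m → 0 ≤ m → h k u = 0) ∧
      (∀ k u, m < u j → m ≤ 0 → h k u = 0) ∧ (m = 0 → h = 0) ∧
      (m ≠ 0 → ∀ u, u j = m → h j u ≠ 0) := by
  rcases lt_trichotomy m 0 with hm | hm | hm
  · obtain ⟨h, h1, h2, h3⟩ := exists_solution_below hL j m
    refine ⟨h, h1, fun k u _ h => by omega, fun k u hu _ => h2 k u hu, by omega, fun _ u hu => ?_⟩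
    rw [h3 u hu]
    exact one_ne_zero
  · exact ⟨0, fun i k _ u => by simp, by simp, by simp, fun _ => rfl, fun h => absurd hm h⟩
  · obtain ⟨h, h1, h2, h3⟩ := exists_solution_above hL hγ j (m - 1)
    exact ⟨h, h1, fun k u hu _ => h2 k u (by omega), fun k u _ h => by omega, by omega,
      fun _ u hu => h3 u (by omega)⟩

/-- The linear system for the discrete Lamé coefficients has a nowhere vanishing solution with
given values at the origin, unless it is forced to vanish at one of the points `corner S`. -/
theorem exists_nonvanishing_solution [Uncountable 𝕜] (hL : LameEquations β) (hγ : IsMetric β γ)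
    (hβ : ∀ i j, i ≠ j → ∀ u, β i j u ≠ 0) {a : Fin n → 𝕜}
    (ha : ∀ (S : Finset (Fin n)) (j : Fin n), j ∉ S → ∑ k ∈ S, β k j (corner S) * a k ≠ a j) :
    ∃ h, IsLameSolution β h ∧ (∀ i, h i 0 = a i) ∧ ∀ i u, h i u ≠ 0 := by
  obtain ⟨h0, hs0, hini⟩ := exists_solution hL a
  choose E E1 E2 E3 E4 E5 using exists_elementary_solution hL hγ
  let F : Option (Fin n × ℤ) → Fin n → (Fin n → ℤ) → 𝕜 := fun s => s.elim h0 fun p => E p.1 p.2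
  have hF : ∀ s, IsLameSolution β (F s) := by
    rintro (_ | ⟨j, m⟩)
    · exact hs0
    · exact E1 j m
  let B : (Fin n → ℤ) → Finset (Option (Fin n × ℤ)) := fun u =>
    insert none ((univ ×ˢ Finset.Icc (-∑ j, |u j|) (∑ j, |u j|)).image some)
  have hB : ∀ k u s, F s k u ≠ 0 → s ∈ B u := by
    rintro k u (_ | ⟨j, m⟩) hs
    · exact mem_insert_self _ _
    · refine mem_insert_of_mem (mem_image_of_mem _ (Finset.mem_product.2 ⟨mem_univ _, ?_⟩))
      have h1 : |m| ≤ |u j| := by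
        by_contra! h
        refine hs ?_
        rcases le_total 0 m with hm | hm
        · refine E2 j m k u ?_ hm
          rw [abs_of_nonneg hm] at h
          exact (le_abs_self _).trans_lt h
        · refine E3 j m k u ?_ hm
          rw [abs_of_nonpos hm] at h
          have := neg_abs_le (u j)
          omega
      have h2 : |u j| ≤ ∑ j, |u j| :=
        Finset.single_le_sum (f := fun j => |u j|) (fun _ _ => abs_nonneg _) (mem_univ j)
      exact Finset.mem_Icc.2 (abs_le.1 (h1.trans h2))
  -- `c k u` is the linear form in the unknown weights giving component `k` at `u` of the weighted
  -- sum of all solutions in the family.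
  let c : Fin n → (Fin n → ℤ) → Option (Fin n × ℤ) →₀ 𝕜 := fun k u =>
    Finsupp.onFinset (B u) (fun s => F s k u) (hB k u)
  have hc : ∀ i k, i ≠ k → ∀ u, c k (up i u) = c k u + β i k u • c i (up i u) := by
    intro i k hik u
    ext s
    simpa [c] using hF s i k hik u
  have hc0 : ∀ k, c k 0 = Finsupp.single none (a k) := by
    intro k
    ext s
    rcases s with _ | ⟨j, m⟩
    · simpa [c, F] using hini k
    · have : E j m k 0 = 0 := by
        rcases lt_trichotomy m 0 with hm | hm | hm
        · exact E3 j m k 0 (by simpa using hm) hm.le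
        · rw [E4 j m hm]; rfl
        · exact E2 j m k 0 (by simpa using hm) hm.le
      simpa [c, F] using this
  have hne : ∀ k u, c k u ≠ 0 := by
    intro j u h
    have hz : ∀ s, F s j u = 0 := fun s => by simpa [c] using DFunLike.congr_fun h s
    by_cases huj : u j = 0
    swap
    · exact E5 j (u j) huj u rfl (hz (some (j, u j)))
    by_cases hpos : ∃ i, 0 < u i
    · obtain ⟨i, hi⟩ := hpos
      have hij : i ≠ j := by rintro rfl; omega
      have h1 := E1 i (u i) i j hij (down i u)
      rw [up_down, E2 i (u i) j (down i u) (by simp) hi.le, zero_add] at h1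
      exact mul_ne_zero (hβ i j hij _) (E5 i (u i) hi.ne' u rfl) (h1.symm.trans (hz (some (i, u i))))
    by_cases hneg : ∃ i, u i < -1
    · obtain ⟨i, hi⟩ := hneg
      have hij : i ≠ j := by rintro rfl; omega
      have h1 := E1 i (u i + 1) i j hij u
      have h2 := E1 i (u i + 1) i j hij (up i u)
      have h3 : ∀ k, E i (u i + 1) k (up i (up i u)) = 0 := fun k =>
        E3 i (u i + 1) k _ (by simp) (by omega)
      rw [h3, h3, mul_zero, add_zero] at h2
      rw [← h2, show E i (u i + 1) j u = 0 from hz (some (i, u i + 1)), zero_add] at h1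
      exact mul_ne_zero (hβ i j hij _) (E5 i (u i + 1) (by omega) (up i u) (by simp)) h1.symm
    push Not at hpos hneg
    have hS : u = corner (univ.filter fun i => u i = -1) := by
      ext i
      have h1 := hpos i
      have h2 := hneg i
      by_cases hi : u i = -1
      · simp [corner, hi]
      · simp only [corner, mem_filter, mem_univ, true_and, hi, if_false]
        omega
    have hjS : j ∉ univ.filter fun i => u i = -1 := by simp [huj]
    have h1 := hs0.apply_corner hL _ hjS
    rw [← hS] at h1
    have h2 := ha _ j hjS
    rw [← hS] at h2
    simp only [hini, show h0 j u = 0 from hz none] at h1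
    exact h2 (sub_eq_zero.1 h1.symm).symm
  -- The extra form keeps the weight of `h0` nonzero, so that dividing by it restores the initial
  -- values.
  obtain ⟨t, ht⟩ := exists_forall_linearCombination_ne_zero (𝕜 := 𝕜)
    (C := insert (Finsupp.single none 1) (Set.range fun p : Fin n × (Fin n → ℤ) => c p.1 p.2))
    ((Set.countable_range _).insert _) (by
      rintro (h | ⟨p, h⟩)
      · exact one_ne_zero (Finsupp.single_eq_zero.1 h.symm)
      · exact hne _ _ h)
  have ht0 : t none ≠ 0 := by simpa using ht _ (Set.mem_insert _ _)
  refine ⟨fun k u => Finsupp.linearCombination 𝕜 t (c k u) / t none, fun i k hik u => ?_,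
    fun i => ?_, fun i u => div_ne_zero (ht _ (Set.mem_insert_of_mem _ ⟨(i, u), rfl⟩)) ht0⟩
  · simp only [hc i k hik u, map_add, map_smul, smul_eq_mul]
    ring
  · simp [hc0, ht0]

/-- The linear system for the discrete Lamé coefficients has a nowhere vanishing solution. -/
theorem exists_nonvanishing_solution' [Uncountable 𝕜] (hL : LameEquations β) (hγ : IsMetric β γ)
    (hβ : ∀ i j, i ≠ j → ∀ u, β i j u ≠ 0) : ∃ h, IsLameSolution β h ∧ ∀ i u, h i u ≠ 0 := by
  let c : Finset (Fin n) × Fin n → Fin n →₀ 𝕜 := fun p =>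
    Finsupp.single p.2 1 - ∑ k ∈ p.1, Finsupp.single k (β k p.2 (corner p.1))
  obtain ⟨a, ha⟩ := exists_forall_linearCombination_ne_zero (𝕜 := 𝕜)
    (C := c '' {p | p.2 ∉ p.1}) (Set.to_countable _) (by
      -- For `j ∉ S` the form `a_j - ∑ β_kj a_k` has coefficient `1` at `j`, so generic initial
      -- values avoid all the obstructions.
      rintro ⟨⟨S, j⟩, hj, h⟩
      have h1 := DFunLike.congr_fun h j
      have h2 : ∑ k ∈ S, (Finsupp.single k (β k j (corner S))) j = 0 :=
        Finset.sum_eq_zero fun k hk => Finsupp.single_eq_of_ne (by rintro rfl; exact hj hk)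
      simp [c, h2] at h1)
  obtain ⟨h, h1, -, h2⟩ := exists_nonvanishing_solution hL hγ hβ (a := a) (by
    intro S j hj h
    refine ha _ ⟨(S, j), hj, rfl⟩ ?_
    simp [c, h])
  exact ⟨h, h1, h2⟩

end Goursat

/-! ### Construction of a lattice from a metric and a solution of the linear system. -/

section Realization

variable {𝕜 : Type*} [Field 𝕜] {n : ℕ} {β : Fin n → Fin n → (Fin n → ℤ) → 𝕜}
  {γ : Fin n → (Fin n → ℤ) → 𝕜}

theorem coplanar_of_mem_span {V : Type*} [AddCommGroup V] [Module 𝕜 V] {p a b : V} {s : Set V}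
    (hp : p ∈ s) (h : ∀ q ∈ s, q - p ∈ Submodule.span 𝕜 {a, b}) : Coplanar 𝕜 s := by
  rw [Coplanar, vectorSpan_eq_span_vsub_set_right 𝕜 hp]
  have h1 : Submodule.span 𝕜 ((· -ᵥ p) '' s) ≤ Submodule.span 𝕜 {a, b} := by
    rw [Submodule.span_le]
    rintro _ ⟨q, hq, rfl⟩
    exact h q hq
  refine (Submodule.rank_mono h1).trans ((rank_span_le _).trans ?_)
  exact Cardinal.mk_insert_le.trans (by rw [Cardinal.mk_singleton, one_add_one_eq_two])

/-- A lattice with prescribed rotation coefficients, edge lengths and discrete Lamé coefficients. -/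
theorem IsMetric.exists_lattice (hγ : IsMetric β γ) (hL : LameEquations β) (h2 : (2 : 𝕜) ≠ 0)
    {ζ : 𝕜} (hζ : ζ ≠ 0) (hsp : ∀ i u, spectral β γ i u = ζ ^ 2)
    {M : Matrix (Fin n) (Fin n) 𝕜} (hM : M * M.transpose = gram β γ 0)
    {H : Fin n → (Fin n → ℤ) → 𝕜} (hH : IsLameSolution β H) (hH0 : ∀ i u, H i u ≠ 0) :
    ∃ (x : (Fin n → ℤ) → Fin n → 𝕜) (hp hm : Fin n → (Fin n → ℤ) → 𝕜),
      IsLattice x ∧ IsLameCoefficients x hp hm ∧ (∀ j u, hp j u = (2 * ζ) ^ (u j) * H j u) ∧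
      ∀ i j, i ≠ j → ∀ u, gauge ζ β i j u = Δ i (hp j) u / T i (hp i) u := by
  have hz : 2 * ζ ≠ 0 := mul_ne_zero h2 hζ
  obtain ⟨Z, hZ0, hZu, hZ⟩ := exists_wave hL hζ (hγ.isUnit_of_factorization hL hM)
  have hG : ∀ u, Z u * (Z u).transpose = gram β γ u := by
    refine lattice_induction (by rw [hZ0, hM]) fun i u => ?_
    have e : Z (up i u) * (Z (up i u)).transpose
        = waveMatrix β ζ i u * (Z u * (Z u).transpose) * (waveMatrix β ζ i u).transpose := by
      rw [hZ, Matrix.transpose_mul]; simp only [Matrix.mul_assoc]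
    have hA := isUnit_waveMatrix (β := β) hζ i u
    rw [e, hγ.gram_up hL ζ, hsp, sub_self, zero_mul, Matrix.single_zero, add_zero,
      ((Matrix.isUnit_transpose _).2 hA).mul_left_inj, hA.mul_right_inj]
  have hdot : ∀ i u a b, Z (up i u) a ⬝ᵥ Z u b = (waveMatrix β ζ i u * gram β γ u) a b := by
    intro i u a b
    rw [← hG, ← Matrix.mul_assoc, ← hZ]
    rfl
  have hdot0 : ∀ i u a, a ≠ i → Z (up i u) a ⬝ᵥ Z u i = 0 := fun i u a ha => by
    rw [hdot, waveMatrix_mul_gram_col ha]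
  have hdotζ : ∀ i u, Z (up i u) i ⬝ᵥ Z u i = ζ * γ i u := fun i u => by
    rw [hdot, waveMatrix_mul_gram_self]
  have hself : ∀ i u, Z u i ⬝ᵥ Z u i = γ i u := fun i u =>
    (congrFun (congrFun (hG u) i) i).trans (gram_self i u)
  have hstep : ∀ i j, i ≠ j → ∀ u, Z (up j u) i = Z u i + β i j (up j u) • Z u j := by
    intro i j hij u
    ext b
    rw [hZ, waveMatrix_mul_of_ne _ hij]; rfl
  -- The edges; the equations for `H` and the step of `Z` make them close up around each square,
  -- inside the plane of `Z_i` and `Z_j`.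
  let f : Fin n → (Fin n → ℤ) → Fin n → 𝕜 := fun i u => (2 * ζ * H i (up i u)) • Z u i
  obtain ⟨x, -, hx⟩ := exists_potential f (by
    intro i j hij u
    have h1 := hH i j hij (up j u)
    have h3 := hH j i hij.symm (up i u)
    ext b
    simp only [f, Pi.add_apply, Pi.smul_apply, smul_eq_mul, hstep j i hij.symm, hstep i j hij]
    rw [up_comm j i] at *
    linear_combination 2 * ζ * Z u j b * h1 - 2 * ζ * Z u i b * h3) 0
  have hedge : ∀ i u, edge x i u = f i u := fun i u => by rw [edge, hx]; abel
  have hedgeNeg : ∀ i u, edgeNeg x i u = -f i (down i u) := fun i u => by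
    have := hx i (down i u)
    rw [up_down] at this
    rw [edgeNeg, this]; abel
  -- The powers of `2ζ` reconcile `⟨Z_i, Z_i⟩ = γ_i` and `⟨T_i Z_i, Z_i⟩ = ζ γ_i` with the factor
  -- `2` occurring only in the first Lamé relation.
  refine ⟨x, fun j u => (2 * ζ) ^ (u j) * H j u,
    fun i u => ζ * (2 * ζ) ^ (-u i) * H i (up i u) * γ i u, ⟨fun u => ?_, fun i j hij u => ?_,
      fun i j hij u => ?_⟩, ⟨fun i u => ?_, fun i u => ?_, fun i j hij u => ?_⟩,
      fun _ _ => rfl, fun i j hij u => ?_⟩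
  · have h1 : LinearIndependent 𝕜 (Z u) := Matrix.linearIndependent_rows_of_isUnit (hZu u)
    have := h1.units_smul fun i => Units.mk0 _ (mul_ne_zero hz (hH0 i (up i u)))
    convert this using 1
    ext i : 1
    exact hedge i u
  · refine coplanar_of_mem_span (a := Z u i) (b := Z u j) (p := x u) (by simp) ?_
    have hi : ∀ c : 𝕜, c • Z u i ∈ Submodule.span 𝕜 {Z u i, Z u j} := fun c =>
      Submodule.smul_mem _ _ (Submodule.subset_span (by simp))
    have hj : ∀ c : 𝕜, c • Z u j ∈ Submodule.span 𝕜 {Z u i, Z u j} := fun c =>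
      Submodule.smul_mem _ _ (Submodule.subset_span (by simp))
    rintro q (rfl | rfl | rfl | rfl)
    · simp
    · rw [hx, add_sub_cancel_left]; exact hi _
    · rw [hx, add_sub_cancel_left]; exact hj _
    · rw [hx, hx, add_assoc, add_sub_cancel_left]
      refine add_mem (hj _) ?_
      simp only [f, hstep i j hij, smul_add, smul_smul]
      exact add_mem (hi _) (hj _)
  · rw [hedge, hedgeNeg]
    have := hdot0 j (down j u) i hij
    rw [up_down] at this
    simp [f, this]
  · simp only [hedge, f, smul_dotProduct, dotProduct_smul, hself, smul_eq_mul, up_self,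
      zpow_add₀ hz, zpow_one, zpow_neg]
    have := zpow_ne_zero (u i) hz
    field_simp
  · obtain ⟨w, rfl⟩ : ∃ w, u = up i w := ⟨down i u, by simp⟩
    simp only [hedge, hedgeNeg, down_up, f, smul_dotProduct, dotProduct_smul, dotProduct_neg,
      smul_eq_mul, up_self, zpow_add₀ hz, zpow_one, zpow_neg, hdotζ]
    have := zpow_ne_zero (w i) hz
    field_simp
  · obtain ⟨w, rfl⟩ : ∃ w, u = up i w := ⟨down i u, by simp⟩
    simp only [hedge, hedgeNeg, down_up, f, smul_dotProduct, dotProduct_smul, dotProduct_neg,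
      smul_eq_mul, up_self, up_of_ne hij, zpow_add₀ hz, zpow_one, zpow_neg, hstep i j hij,
      add_dotProduct, hdotζ, hdot0 i w j hij.symm]
    have := zpow_ne_zero (w i) hz
    field_simp
    ring
  · simp only [gauge, Δ, T, up_self, up_of_ne hij.symm, hH i j hij u, zpow_sub₀ hz, zpow_add₀ hz,
      zpow_one]
    have h1 := zpow_ne_zero (u i) hz
    have h3 := hH0 i (up i u)
    field_simp
    ring

end Realization

/-! ### From a lattice to the linear system. -/

section Necessity

variable {𝕜 : Type*} [Field 𝕜] {n : ℕ} {β : Fin n → Fin n → (Fin n → ℤ) → 𝕜}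
  {γ : Fin n → (Fin n → ℤ) → 𝕜}

theorem Coplanar.sub_mem_span {V : Type*} [AddCommGroup V] [Module 𝕜 V] [FiniteDimensional 𝕜 V]
    {s : Set V} (hs : Coplanar 𝕜 s) {p q r t : V} (hp : p ∈ s) (hq : q ∈ s) (hr : r ∈ s)
    (ht : t ∈ s) (hli : LinearIndependent 𝕜 ![q - p, r - p]) :
    t - p ∈ Submodule.span 𝕜 {q - p, r - p} := by
  have h1 : Submodule.span 𝕜 {q - p, r - p} ≤ vectorSpan 𝕜 s := by
    rw [Submodule.span_le]
    rintro _ (rfl | rfl)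
    · exact vsub_mem_vectorSpan 𝕜 hq hp
    · exact vsub_mem_vectorSpan 𝕜 hr hp
  have h2 : Module.finrank 𝕜 (Submodule.span 𝕜 {q - p, r - p}) = 2 := by
    have := finrank_span_eq_card hli
    rwa [Matrix.range_cons_cons_empty, Fintype.card_fin] at this
  rw [Submodule.eq_of_le_of_finrank_le h1 (by
    rw [h2]; exact coplanar_iff_finrank_le_two.1 hs)]
  exact vsub_mem_vectorSpan 𝕜 ht hp

theorem LinearIndependent.pair {ι V : Type*} [AddCommGroup V] [Module 𝕜 V] {f : ι → V}
    (hf : LinearIndependent 𝕜 f) {i j : ι} (hij : i ≠ j) :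
    LinearIndependent 𝕜 ![f i, f j] := by
  have := hf.comp ![i, j] (by
    intro a b hab
    fin_cases a <;> fin_cases b <;> simp_all [hij.symm])
  convert this using 1
  ext a
  fin_cases a <;> rfl

theorem eq_zero_of_dotProduct_eq_zero {M : Matrix (Fin n) (Fin n) 𝕜} (hM : IsUnit M)
    {y : Fin n → 𝕜} (h : ∀ i, M i ⬝ᵥ y = 0) : y = 0 := by
  have := (Matrix.mulVec_injective_iff_isUnit.2 hM)
  exact this ((funext h : M.mulVec y = 0).trans (Matrix.mulVec_zero M).symm)

/-- The normalized edges of a Darboux-Egoroff lattice satisfy the linear system, and their Gram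
matrix is `gram β γ`. -/
theorem IsLattice.exists_wave {x : (Fin n → ℤ) → Fin n → 𝕜} {hp hm : Fin n → (Fin n → ℤ) → 𝕜}
    (hx : IsLattice x) (hl : IsLameCoefficients x hp hm) (h2 : (2 : 𝕜) ≠ 0) {ζ : 𝕜} (hζ : ζ ≠ 0)
    (hrot : ∀ i j, i ≠ j → ∀ u, gauge ζ β i j u = Δ i (hp j) u / T i (hp i) u) :
    ∃ (H γ : Fin n → (Fin n → ℤ) → 𝕜) (Z : (Fin n → ℤ) → Matrix (Fin n) (Fin n) 𝕜),
      (∀ j u, hp j u = (2 * ζ) ^ (u j) * H j u) ∧ IsLameSolution β H ∧ (∀ i u, H i u ≠ 0) ∧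
      IsMetric β γ ∧ (∀ u, IsUnit (Z u)) ∧ (∀ u, Z u * (Z u).transpose = gram β γ u) ∧
      ∀ i u, Z (up i u) = waveMatrix β ζ i u * Z u := by
  have hz : 2 * ζ ≠ 0 := mul_ne_zero h2 hζ
  set X := edge x with hX
  have hneg : ∀ i u, edgeNeg x i u = -X i (down i u) := fun i u => by
    simp [hX, edge, edgeNeg]
  have hXu : ∀ u, IsUnit (Matrix.of fun i => X i u) := fun u =>
    Matrix.linearIndependent_rows_iff_isUnit.1 (hx.nondegenerate u)
  have horth : ∀ i j, i ≠ j → ∀ u, X i (up j u) ⬝ᵥ X j u = 0 := fun i j hij u => by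
    have := hx.orthogonal i j hij (up j u)
    rw [hneg, down_up, dotProduct_neg, neg_eq_zero] at this
    exact this
  have hii : ∀ i u, X i (up i u) ⬝ᵥ X i u = hp i (up i (up i u)) * hm i u := fun i u => by
    have := hl.edge_edgeNeg i (up i u)
    rw [hneg, down_up, dotProduct_neg, neg_inj] at this
    exact this
  have hij' : ∀ i j, i ≠ j → ∀ u,
      X i (up j (up i u)) ⬝ᵥ X i u = hp i (up i (up j (up i u))) * hm i u := fun i j hij u => by
    have := hl.shift_edge_edgeNeg i j hij (up i u)
    rw [hneg, down_up, dotProduct_neg, neg_inj] at this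
    exact this
  -- Otherwise `X_i(u)` would be orthogonal to the whole basis at `u + e_i`.
  have hne : ∀ i u, hp i (up i (up i u)) * hm i u ≠ 0 := by
    intro i u h
    refine (hx.nondegenerate u).ne_zero i (eq_zero_of_dotProduct_eq_zero (hXu (up i u)) fun k => ?_)
    by_cases hk : k = i
    · subst hk; exact (hii k u).trans h
    · exact horth k i hk u
  have hp0 : ∀ i u, hp i u ≠ 0 := fun i u => by
    have := left_ne_zero_of_mul (hne i (down i (down i u)))
    rwa [up_down, up_down] at this
  have hm0 : ∀ i u, hm i u ≠ 0 := fun i u => right_ne_zero_of_mul (hne i u)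
  let H : Fin n → (Fin n → ℤ) → 𝕜 := fun j u => (2 * ζ) ^ (-u j) * hp j u
  have hpH : ∀ j u, hp j u = (2 * ζ) ^ (u j) * H j u := fun j u => by
    rw [← mul_assoc, ← zpow_add₀ hz, add_neg_cancel, zpow_zero, one_mul]
  have hH0 : ∀ i u, H i u ≠ 0 := fun i u => mul_ne_zero (zpow_ne_zero _ hz) (hp0 i u)
  have hH : IsLameSolution β H := by
    intro i j hij u
    have h1 := hrot i j hij u
    have h3 := hH0 i (up i u)
    simp only [gauge, Δ, T, hpH, up_self, up_of_ne hij.symm, zpow_sub₀ hz, zpow_add₀ hz,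
      zpow_one] at h1
    have h4 := zpow_ne_zero (u i) hz
    have h5 := zpow_ne_zero (u j) hz
    field_simp at h1
    linear_combination -h1
  obtain ⟨Z, hZ⟩ : ∃ Z : (Fin n → ℤ) → Fin n → Fin n → 𝕜,
      ∀ u i, Z u i = (2 * ζ * H i (up i u))⁻¹ • X i u := ⟨_, fun _ _ => rfl⟩
  have hc : ∀ i u, 2 * ζ * H i (up i u) ≠ 0 := fun i u => mul_ne_zero hz (hH0 _ _)
  have hXZ : ∀ i u, X i u = (2 * ζ * H i (up i u)) • Z u i := fun i u =>
    by rw [hZ, smul_inv_smul₀ (hc i u)]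
  have hli : ∀ u, LinearIndependent 𝕜 (Z u) := fun u => by
    convert (hx.nondegenerate u).units_smul fun i => (Units.mk0 _ (hc i u))⁻¹ using 1
    ext i : 1
    exact hZ u i
  have hZu : ∀ u, IsUnit (Matrix.of (Z u)) := fun u =>
    Matrix.linearIndependent_rows_iff_isUnit.1 (hli u)
  have pair : ∀ u i j, i ≠ j → ∀ a b : 𝕜, a • Z u i + b • Z u j = 0 → b = 0 :=
    fun u i j hij a b h => (LinearIndependent.pair_iff.1
      (LinearIndependent.pair (hli u) hij) a b h).2
  have hZorth : ∀ i j, i ≠ j → ∀ u, Z (up j u) i ⬝ᵥ Z u j = 0 := fun i j hij u => by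
    simp [hZ, horth i j hij u]
  have hplane : ∀ i j, i ≠ j → ∀ u, ∃ b : 𝕜, Z (up j u) i = Z u i + b • Z u j := by
    intro i j hij u
    have h1 := Coplanar.sub_mem_span (hx.planar i j hij u) (p := x u) (q := x (up i u))
      (r := x (up j u)) (t := x (up i (up j u))) (by simp) (by simp) (by simp) (by simp)
      (LinearIndependent.pair (hx.nondegenerate u) hij)
    obtain ⟨a, b, hab⟩ := Submodule.mem_span_pair.1 h1
    have h3 : X i (up j u) = a • X i u + (b - 1) • X j u := by
      have : X i (up j u) = x (up i (up j u)) - x u - X j u := by simp [hX, edge]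
      rw [this, ← hab, sub_smul, one_smul]
      simp only [hX, edge]
      abel
    -- Pairing with the preceding edge `X_i(u - e_i)` kills the `X_j` term and compares the second
    -- and third Lamé relations.
    have h4 : hp i (up i (up j u)) = a * hp i (up i u) := by
      obtain ⟨w, rfl⟩ : ∃ w, u = up i w := ⟨down i u, by simp⟩
      have h5 := hij' i j hij w
      rw [h3, add_dotProduct, smul_dotProduct, smul_dotProduct, hii, horth j i hij.symm] at h5
      refine mul_right_cancel₀ (hm0 i w) ?_
      rw [← h5, smul_eq_mul, smul_zero, add_zero, mul_assoc]
    have h6 : H i (up i (up j u)) = a * H i (up i u) := by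
      simp only [hpH, up_self, up_of_ne hij] at h4
      refine mul_left_cancel₀ (zpow_ne_zero (u i + 1) hz) ?_
      rw [h4]; ring
    refine ⟨(2 * ζ * H i (up i (up j u)))⁻¹ * ((b - 1) * (2 * ζ * H j (up j u))), ?_⟩
    have ha : a ≠ 0 := by
      rintro rfl
      exact hH0 i (up i (up j u)) (by rw [h6, zero_mul])
    rw [hZ, h3, smul_add, hXZ j u, hZ u i, smul_smul, smul_smul, smul_smul, ← mul_assoc _ (b - 1)]
    congr 2
    rw [h6]
    have := hH0 i (up i u)
    field_simp
  have hstep : ∀ i j, i ≠ j → ∀ u, Z (up j u) i = Z u i + β i j (up j u) • Z u j := by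
    intro i j hij u
    obtain ⟨b, hb⟩ := hplane i j hij u
    obtain ⟨c, hc'⟩ := hplane j i hij.symm u
    have h1 : X i (up j u) + X j u = X j (up i u) + X i u := by
      simp only [hX, edge, up_comm i j]; abel
    rw [hXZ, hXZ, hXZ, hXZ, hb, hc', up_comm i j] at h1
    have h3 := hH i j hij (up j u)
    rw [up_comm i j] at h3
    have h4 := pair u i j hij
      (2 * ζ * (H i (up j (up i u)) - H i (up i u) - c * H j (up j (up i u))))
      (2 * ζ * (H i (up j (up i u)) * b + H j (up j u) - H j (up j (up i u)))) (by
        ext k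
        have := congrFun h1 k
        simp only [Pi.add_apply, Pi.smul_apply, smul_eq_mul, Pi.zero_apply] at *
        linear_combination this)
    -- The quadrilateral closes, and the coefficient of `Z_j` turns this into the defining relation
    -- of `β`.
    have h5 : b = β i j (up j u) := by
      refine mul_left_cancel₀ (hH0 i (up j (up i u))) (mul_left_cancel₀ hz ?_)
      linear_combination h4 + 2 * ζ * h3
    rw [hb, h5]
  obtain ⟨γ, hγ⟩ : ∃ γ : Fin n → (Fin n → ℤ) → 𝕜, ∀ i u, Z u i ⬝ᵥ Z u i = γ i u :=
    ⟨_, fun _ _ => rfl⟩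
  have hγm : ∀ i u, ζ * H i (up i u) * γ i u = (2 * ζ) ^ (u i) * hm i u := by
    intro i u
    have h1 := hl.edge_edge i u
    rw [← hX, hXZ, smul_dotProduct, dotProduct_smul, hγ, hpH, up_self, zpow_add₀ hz, zpow_one,
      smul_eq_mul, smul_eq_mul] at h1
    have h3 : 2 * (2 * ζ) * H i (up i u) ≠ 0 := mul_ne_zero (mul_ne_zero h2 hz) (hH0 _ _)
    refine mul_left_cancel₀ h3 ?_
    linear_combination h1
  have hγ0 : ∀ i u, γ i u ≠ 0 := fun i u =>
    right_ne_zero_of_mul ((hγm i u).symm ▸ mul_ne_zero (zpow_ne_zero _ hz) (hm0 i u))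
  have hζγ : ∀ i u, Z (up i u) i ⬝ᵥ Z u i = ζ * γ i u := by
    intro i u
    have h1 := hii i u
    rw [hXZ, hXZ, smul_dotProduct, dotProduct_smul, hpH, up_self, up_self, zpow_add₀ hz,
      zpow_add₀ hz, zpow_one, smul_eq_mul, smul_eq_mul] at h1
    refine mul_left_cancel₀ (mul_ne_zero (hc i (up i u)) (hc i u)) ?_
    linear_combination h1 - (2 * ζ) ^ 2 * H i (up i (up i u)) * hγm i u
  have hgram : ∀ i j, i ≠ j → ∀ u, Z u i ⬝ᵥ Z u j = -(β i j (up j u) * γ j u) := by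
    intro i j hij u
    have := hZorth i j hij u
    rw [hstep i j hij, add_dotProduct, smul_dotProduct, smul_eq_mul, hγ] at this
    linear_combination this
  have hmet : IsMetric β γ := by
    have symm : ∀ i j, i ≠ j → ∀ u, β j i (up i u) * γ i u = β i j (up j u) * γ j u := by
      intro i j hij u
      have h1 := hgram i j hij u
      rw [dotProduct_comm, hgram j i hij.symm u] at h1
      linear_combination -h1
    refine ⟨hγ0, symm, fun i j hij u => ?_⟩
    rw [← hγ i (up j u)]
    simp only [hstep i j hij u, add_dotProduct, dotProduct_add, smul_dotProduct,
      dotProduct_smul, smul_eq_mul, hgram i j hij, hgram j i hij.symm, pairProduct, T, hγ]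
    have := symm i j hij u
    linear_combination 0 * this
  have hG : ∀ u, Matrix.of (Z u) * (Matrix.of (Z u)).transpose = gram β γ u := by
    intro u
    ext a b
    change Z u a ⬝ᵥ Z u b = _
    by_cases hab : a = b
    · subst hab; rw [gram_self, hγ]
    · rw [gram_of_ne hab, hgram a b hab]
  refine ⟨H, γ, fun u => Matrix.of (Z u), hpH, hH, hH0, hmet, hZu, hG, ?_⟩
  have hvec : ∀ i u, Z (up i u) i
      = (ζ + v β i u) • Z u i - ∑ k ∈ univ.erase i, β i k u • Z u k := by
    intro i u
    obtain ⟨c, hc'⟩ : ∃ c : Fin n → 𝕜, Z (up i u) i = ∑ k, c k • Z u k := by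
      refine ⟨Matrix.vecMul (Z (up i u) i) (Matrix.of (Z u))⁻¹, ?_⟩
      have h1 : Matrix.vecMul (Matrix.vecMul (Z (up i u) i) (Matrix.of (Z u))⁻¹) (Matrix.of (Z u))
          = Z (up i u) i := by
        rw [Matrix.vecMul_vecMul, Matrix.nonsing_inv_mul _
          ((Matrix.isUnit_iff_isUnit_det _).1 (hZu u)), Matrix.vecMul_one]
      ext b
      conv_lhs => rw [← h1]
      simp [Matrix.vecMul, dotProduct]
    -- Pairing with `Z_j(u - e_j)`, orthogonal to every `Z_k(u)` with `k ≠ j`, isolates `c_j`. The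
    -- vector is known against `Z_j` at `u - e_j + e_i` and against `Z_i` at `u`; expanding both at
    -- `u - e_j` and eliminating gives `c_j`.
    have hck : ∀ k, k ≠ i → c k = -β i k u := by
      intro j hj
      obtain ⟨w, rfl⟩ : ∃ w, u = up j w := ⟨down j u, by simp⟩
      have h1 : Z (up i (up j w)) i ⬝ᵥ Z w j = c j * (ζ * γ j w) := by
        rw [hc', sum_dotProduct, Finset.sum_eq_single j]
        · rw [smul_dotProduct, hζγ, smul_eq_mul]
        · intro k _ hk
          rw [smul_dotProduct, hZorth k j hk, smul_zero]
        · simp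
      have h3 := hZorth i j hj.symm (up i w)
      have h4 := hζγ i (up j w)
      rw [hmet.shift i j hj.symm w, hstep i j hj.symm w, dotProduct_add, dotProduct_smul, h1,
        smul_eq_mul] at h4
      rw [← up_comm i j, hstep j i hj, dotProduct_add, dotProduct_smul, h1, smul_eq_mul] at h3
      have h5 := hmet.symm i j hj.symm w
      have h6 := right_ne_zero_of_mul (hmet.shift i j hj.symm w ▸ hγ0 i (up j w))
      simp only [pairProduct, T] at h4 h6
      refine mul_right_cancel₀ (mul_ne_zero (mul_ne_zero h6 hζ) (hγ0 j w)) ?_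
      linear_combination h3 - β j i (up i w) * h4
        - ζ * (1 - β i j (up j w) * β j i (up i w)) * h5
    have hci : c i = ζ + v β i u := by
      have h1 := hζγ i u
      rw [hc', sum_dotProduct, ← Finset.add_sum_erase _ _ (mem_univ i), smul_dotProduct, hγ,
        smul_eq_mul] at h1
      have h3 : ∑ k ∈ univ.erase i, (c k • Z u k) ⬝ᵥ Z u i = -v β i u * γ i u := by
        rw [v_eq, neg_neg, Finset.sum_mul]
        refine Finset.sum_congr rfl fun k hk => ?_
        have hk := (Finset.mem_erase.1 hk).1
        rw [hck k hk, smul_dotProduct, hgram k i hk, smul_eq_mul]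
        ring
      refine mul_right_cancel₀ (hγ0 i u) ?_
      linear_combination h1 - h3
    rw [hc', ← Finset.add_sum_erase _ _ (mem_univ i), hci, sub_eq_add_neg,
      ← Finset.sum_neg_distrib]
    congr 1
    refine Finset.sum_congr rfl fun k hk => ?_
    rw [hck k (Finset.mem_erase.1 hk).1, neg_smul]
  intro i u
  ext a b
  by_cases ha : a = i
  · subst ha
    rw [waveMatrix_mul_self]
    simpa using congrFun (hvec a u) b
  · rw [waveMatrix_mul_of_ne _ ha]
    simpa using congrFun (hstep a i ha u) b

end Necessity

/-! ### The spectral constant as an invariant of `β`, and the conclusion. -/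

section Main

variable {𝕜 : Type*} [Field 𝕜] {n : ℕ} {β : Fin n → Fin n → (Fin n → ℤ) → 𝕜}
  {γ : Fin n → (Fin n → ℤ) → 𝕜}

theorem LameEquations.of_wave {ζ : 𝕜} {Z : (Fin n → ℤ) → Matrix (Fin n) (Fin n) 𝕜}
    (hZu : ∀ u, IsUnit (Z u)) (hZ : ∀ i u, Z (up i u) = waveMatrix β ζ i u * Z u) :
    LameEquations β := by
  refine LameEquations.of_waveMatrix_compat (ζ := ζ) fun i j _ u => (hZu u).mul_right_cancel ?_
  rw [Matrix.mul_assoc, Matrix.mul_assoc, ← hZ, ← hZ, ← hZ, ← hZ, up_comm]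

theorem IsMetric.tripleProduct (hγ : IsMetric β γ) : TripleProduct β := by
  intro i j k hij hjk hik u
  simp only [T]
  refine mul_right_cancel₀ (mul_ne_zero (mul_ne_zero (hγ.ne_zero i u) (hγ.ne_zero j u))
    (hγ.ne_zero k u)) ?_
  have h1 := hγ.symm i j hij u
  have h2 := hγ.symm j k hjk u
  have h3 := hγ.symm i k hik u
  linear_combination (β i k (up k u) * γ k u * β k j (up j u) * γ j u) * h1
    + (β i k (up k u) * γ k u * β i j (up j u) * γ j u) * h2
    - (β i j (up j u) * γ j u * β j k (up k u) * γ k u) * h3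

theorem IsMetric.pairProduct_ne_one (hγ : IsMetric β γ) {i j : Fin n} (hij : i ≠ j)
    (u : Fin n → ℤ) : pairProduct β i j u ≠ 1 := by
  intro h
  have := hγ.shift i j hij u
  rw [h, sub_self, mul_zero] at this
  exact hγ.ne_zero _ _ this

/-- For an actual lattice the linear system transports the Gram matrix exactly, so the diagonal
error vanishes. -/
theorem IsMetric.spectral_eq_sq (hγ : IsMetric β γ) {ζ : 𝕜}
    {Z : (Fin n → ℤ) → Matrix (Fin n) (Fin n) 𝕜}
    (hG : ∀ u, Z u * (Z u).transpose = gram β γ u)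
    (hZ : ∀ i u, Z (up i u) = waveMatrix β ζ i u * Z u) (i : Fin n) (u : Fin n → ℤ) :
    spectral β γ i u = ζ ^ 2 := by
  have h1 : gram β γ (up i u)
      = waveMatrix β ζ i u * gram β γ u * (waveMatrix β ζ i u).transpose := by
    rw [← hG, ← hG, hZ, Matrix.transpose_mul]
    simp only [Matrix.mul_assoc]
  have h2 := congrFun (congrFun h1 i) i
  rw [gram_self, hγ.waveMatrix_conj_self] at h2
  rw [spectral, h2, add_sub_cancel_right, mul_div_cancel_right₀ _ (hγ.ne_zero i u)]

/-- The metric is determined up to a constant factor, so the spectral function does not depend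
on its choice. -/
theorem IsMetric.spectral_unique {γ' : Fin n → (Fin n → ℤ) → 𝕜} (hγ : IsMetric β γ)
    (hγ' : IsMetric β γ') (hβ : ∀ i j, i ≠ j → ∀ u, β i j u ≠ 0) {i j : Fin n} (hij : i ≠ j)
    (u : Fin n → ℤ) : spectral β γ' i u = spectral β γ i u := by
  obtain ⟨c, hc⟩ : ∃ c, γ' i u = c * γ i u :=
    ⟨γ' i u / γ i u, (div_mul_cancel₀ _ (hγ.ne_zero i u)).symm⟩
  have prop : ∀ (k l : Fin n) (w : Fin n → ℤ), γ' k w = c * γ k w → γ' l w = c * γ l w := by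
    intro k l w h
    by_cases hkl : k = l
    · exact hkl ▸ h
    refine mul_left_cancel₀ (hβ k l hkl (up l w)) ?_
    linear_combination β l k (up k w) * h - hγ'.symm k l hkl w + c * hγ.symm k l hkl w
  have h0 : ∀ k, γ' k u = c * γ k u := fun k => prop i k u hc
  -- The metric prescribes no growth of `γ_i` in direction `i`; the factor `c` is carried over by
  -- `γ_j`.
  have h1 : γ' i (up i u) = c * γ i (up i u) := by
    refine prop j i _ ?_
    rw [hγ'.shift j i hij.symm, hγ.shift j i hij.symm, h0, mul_assoc]
  have hc0 : c ≠ 0 := by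
    rintro rfl
    exact hγ'.ne_zero i u (by rw [hc, zero_mul])
  have h2 : gram β γ' u = c • gram β γ u := by
    ext a b
    simp only [gram, Matrix.of_apply, Matrix.smul_apply, smul_eq_mul, h0]
    split_ifs <;> ring
  rw [spectral, spectral, h0, h1, h2, Matrix.mul_smul, Matrix.smul_mul, Matrix.smul_apply,
    smul_eq_mul, ← mul_sub, mul_div_mul_left _ _ hc0]

theorem IsNormalizedRotationCoefficients.isRotationCoefficients
    (h : IsNormalizedRotationCoefficients β) : IsRotationCoefficients β := by
  obtain ⟨x, hp, hm, h1, h2, -, h3⟩ := h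
  exact ⟨x, hp, hm, h1, h2, h3⟩

theorem IsNormalizedRotationCoefficients.admitsNormalization (h2 : (2 : 𝕜) ≠ 0) {ζ : 𝕜}
    (hζ : ζ ≠ 0) (h : IsNormalizedRotationCoefficients (gauge ζ β)) : AdmitsNormalization β := by
  obtain ⟨x, hp, hm, hx, hl, h1, hrot⟩ := h
  obtain ⟨H, γ, Z, hpH, hH, hH0, -, hZu, -, hZ⟩ := hx.exists_wave hl h2 hζ hrot
  have hL := LameEquations.of_wave hZu hZ
  have hini : ∀ i, H i 0 = 1 := fun i => by simpa [hpH] using h1 i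
  intro S j hj hS
  refine hH0 j (corner S) ?_
  rw [hH.apply_corner hL S hj]
  simp [hini, hS]

theorem IsMetric.isRotationCoefficients_iff [Uncountable 𝕜] (hn : 3 ≤ n) (h2 : (2 : 𝕜) ≠ 0)
    (hγ : IsMetric β γ) (hL : LameEquations β) (hβ : ∀ i j, i ≠ j → ∀ u, β i j u ≠ 0) {η : 𝕜}
    (hη : ∀ i u, spectral β γ i u = η ^ 2) {M : Matrix (Fin n) (Fin n) 𝕜}
    (hM : M * M.transpose = gram β γ 0) {ζ : 𝕜} (hζ : ζ ≠ 0) :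
    (IsRotationCoefficients (gauge ζ β) ↔ ζ = η ∨ ζ = -η) ∧
      (IsNormalizedRotationCoefficients (gauge ζ β) ↔
        (ζ = η ∨ ζ = -η) ∧ AdmitsNormalization β) := by
  have : Nontrivial (Fin n) := Fin.nontrivial_iff_two_le.2 (by omega)
  have hnec : IsRotationCoefficients (gauge ζ β) → ζ = η ∨ ζ = -η := by
    rintro ⟨x, hp, hm, hx, hl, hrot⟩
    obtain ⟨H, γ', Z, -, -, -, hγ', -, hG, hZ⟩ := hx.exists_wave hl h2 hζ hrot
    obtain ⟨i, j, hij⟩ := exists_pair_ne (Fin n)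
    rw [← sq_eq_sq_iff_eq_or_eq_neg, ← hη i 0, ← hγ'.spectral_eq_sq hG hZ i 0]
    exact hγ.spectral_unique hγ' hβ hij 0
  have hsp : ζ = η ∨ ζ = -η → ∀ i u, spectral β γ i u = ζ ^ 2 := fun h i u => by
    rw [hη, sq_eq_sq_iff_eq_or_eq_neg.2 h]
  refine ⟨⟨hnec, fun h => ?_⟩, fun h => ⟨hnec h.isRotationCoefficients,
    h.admitsNormalization h2 hζ⟩, fun ⟨h, ha⟩ => ?_⟩
  · obtain ⟨H, hH, hH0⟩ := exists_nonvanishing_solution' hL hγ hβ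
    obtain ⟨x, hp, hm, hx, hl, -, hrot⟩ := hγ.exists_lattice hL h2 hζ (hsp h) hM hH hH0
    exact ⟨x, hp, hm, hx, hl, hrot⟩
  · obtain ⟨H, hH, hini, hH0⟩ := exists_nonvanishing_solution hL hγ hβ (a := fun _ => 1)
      (fun S j hj => by simpa using ha S j hj)
    obtain ⟨x, hp, hm, hx, hl, hpH, hrot⟩ := hγ.exists_lattice hL h2 hζ (hsp h) hM hH hH0
    exact ⟨x, hp, hm, hx, hl, fun i => by simp [hpH, hini], hrot⟩

end Main

end DarbouxEgoroff

theorem theorem3p2 (n : ℕ) (hn : 3 ≤ n) :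
    -- complex lattices
    (∀ β : Fin n → Fin n → (Fin n → ℤ) → ℂ,
      (∀ i j, i ≠ j → ∀ u, β i j u ≠ 0) →
      (∀ i j, i ≠ j → ∀ u, pairProduct β i j u ≠ 1) →
      TripleProduct β → LameEquations β →
      ∃ η : ℂ, η ≠ 0 ∧ ∀ ζ : ℂ, ζ ≠ 0 →
        (IsRotationCoefficients (gauge ζ β) ↔ ζ = η ∨ ζ = -η) ∧
        (IsNormalizedRotationCoefficients (gauge ζ β) ↔
          (ζ = η ∨ ζ = -η) ∧ AdmitsNormalization β)) ∧
    -- lattices in real Euclidean space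
    (∀ β : Fin n → Fin n → (Fin n → ℤ) → ℝ,
      (∀ i j, i ≠ j → ∀ u, 0 < pairProduct β i j u ∧ pairProduct β i j u < 1) →
      TripleProduct β → LameEquations β →
      ∃ η : ℝ, η ≠ 0 ∧ ∀ ζ : ℝ, ζ ≠ 0 →
        (IsRotationCoefficients (gauge ζ β) ↔ ζ = η ∨ ζ = -η) ∧
        (IsNormalizedRotationCoefficients (gauge ζ β) ↔
          (ζ = η ∨ ζ = -η) ∧ AdmitsNormalization β)) ∧
    -- necessity, up to gauge, in both cases
    (∀ (β : Fin n → Fin n → (Fin n → ℤ) → ℂ) (ζ : ℂ), ζ ≠ 0 →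
      IsRotationCoefficients (gauge ζ β) →
      TripleProduct β ∧ LameEquations β ∧
        ∀ i j, i ≠ j → ∀ u, pairProduct β i j u ≠ 1) ∧
    (∀ (β : Fin n → Fin n → (Fin n → ℤ) → ℝ) (ζ : ℝ), ζ ≠ 0 →
      IsRotationCoefficients (gauge ζ β) →
      TripleProduct β ∧ LameEquations β ∧
        ∀ i j, i ≠ j → ∀ u, 0 ≤ pairProduct β i j u ∧ pairProduct β i j u < 1) := by
  let o : Fin n := ⟨0, by omega⟩
  refine ⟨fun β hβ hp hT hL => ?_, fun β hp hT hL => ?_, fun β ζ hζ h => ?_, fun β ζ hζ h => ?_⟩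
  · obtain ⟨γ, hγ, -⟩ := exists_isMetric hn hβ hp hT hL
    obtain ⟨η, hη⟩ := IsAlgClosed.exists_eq_mul_self (spectral β γ o 0)
    have hη' : ∀ i u, spectral β γ i u = η ^ 2 := fun i u => by
      rw [hγ.spectral_eq hn hL hβ i o u, hη, sq]
    obtain ⟨M, hM⟩ := hγ.exists_factorization hL (fun i u => IsAlgClosed.exists_eq_mul_self _) 0
    have : Uncountable ℂ := Complex.ofReal_injective.uncountable
    refine ⟨η, ?_, fun ζ hζ => hγ.isRotationCoefficients_iff hn two_ne_zero hL hβ hη' hM hζ⟩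
    rintro rfl
    exact hγ.spectral_ne_zero hL o 0 (by simp [hη'])
  · have hβ : ∀ i j, i ≠ j → ∀ u, β i j u ≠ 0 := fun i j hij u h => by
      have := (hp i j hij (down j u)).1
      simp [pairProduct, T, h] at this
    obtain ⟨γ, hγ, h0⟩ := exists_isMetric hn hβ (fun i j hij u => (hp i j hij u).2.ne) hT hL
    -- Positivity supplies the real square roots, both for the pivots of the Gram matrix and for the
    -- spectral constant.
    have hpos := hγ.pos hn hp h0
    have hη' : ∀ i u, spectral β γ i u = √(spectral β γ o 0) ^ 2 := fun i u => by
      rw [hγ.spectral_eq hn hL hβ i o u, Real.sq_sqrt (hγ.spectral_pos hL hpos o 0).le]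
    obtain ⟨M, hM⟩ := hγ.exists_factorization hL
      (fun i u => ⟨_, (Real.mul_self_sqrt (hpos i u).le).symm⟩) 0
    exact ⟨√(spectral β γ o 0), (Real.sqrt_pos.2 (hγ.spectral_pos hL hpos o 0)).ne',
      fun ζ hζ => hγ.isRotationCoefficients_iff hn two_ne_zero hL hβ hη' hM hζ⟩
  · obtain ⟨x, hp, hm, hx, hl, hrot⟩ := h
    obtain ⟨H, γ, Z, -, -, -, hγ, hZu, -, hZ⟩ := hx.exists_wave hl two_ne_zero hζ hrot
    exact ⟨hγ.tripleProduct, LameEquations.of_wave hZu hZ,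
      fun i j hij u => hγ.pairProduct_ne_one hij u⟩
  · obtain ⟨x, hp, hm, hx, hl, hrot⟩ := h
    obtain ⟨H, γ, Z, -, -, -, hγ, hZu, hG, hZ⟩ := hx.exists_wave hl two_ne_zero hζ hrot
    refine ⟨hγ.tripleProduct, LameEquations.of_wave hZu hZ, fun i j hij u => ?_⟩
    have hpos : ∀ i u, 0 < γ i u := fun i u => by
      refine lt_of_le_of_ne ?_ (hγ.ne_zero i u).symm
      have h1 : γ i u = ∑ k, Z u i k * Z u i k := by
        rw [← gram_self (β := β) (γ := γ) i u, ← hG, Matrix.mul_apply]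
        rfl
      rw [h1]
      exact Finset.sum_nonneg fun k _ => mul_self_nonneg _
    constructor
    · have h1 : pairProduct β i j u * γ i u = β i j (up j u) ^ 2 * γ j u := by
        simp only [pairProduct, T]
        linear_combination β i j (up j u) * hγ.symm i j hij u
      exact nonneg_of_mul_nonneg_left
        (h1 ▸ mul_nonneg (sq_nonneg _) (hpos j u).le) (hpos i u)
    · have h1 := hγ.shift i j hij u ▸ hpos i (up j u)
      exact sub_pos.1 (pos_of_mul_pos_right h1 (hpos i u).le)
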